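/- Let $T^2=\mathbb R^2/\mathbb Z^2$ be the two-dimensional torus. Metrics, functions and vector fields on $T^2$ are $C^\infty$. A Lorentzian metric $g$ on $T^2$ is \emph{flat} if its curvature tensor vanishes, and \emph{conformally flat} if $g=\Omega g_0$ on all of $T^2$ for some flat Lorentzian metric $g_0$ on $T^2$ and some smooth function $\Omega>0$ on $T^2$. A vector field $K$ is \emph{conformal} if $\mathcal L_K g=2\sigma g$ for some $\sigma\in C^\infty(T^2)$; a tangent vector $v$ is timelike, lightlike or spacelike if $g(v,v)<0$; $g(v,v)=0$ and $v\neq 0$; or $g(v,v)>0$, respectively, and $K$ is timelike (spacelike) if it is so at every point. The metric $g$ is \emph{complete} if every geodesic of $g$ extends to a geodesic defined on all of $\mathbb R$; it is timelike (resp. lightlike, spacelike) \emph{incomplete} if some geodesic with timelike (resp. lightlike, spacelike) velocity does not so extend. For $0\le r\le\infty$, the $C^r$ topology on the set of Lorentzian metrics on $T^2$ is that of uniform convergence of the components in the standard coordinates together with all their partial derivatives of order at most $r$. (1) For every Lorentzian metric $g$ on $T^2$ the following are equivalent: $g$ is conformally flat; $g$ admits a timelike conformal vector field; $g$ admits a spacelike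 conformal vector field. Moreover, every conformally flat $g$ is complete. (2) Let $0\le r\le\infty$. Every conformally flat Lorentzian metric on $T^2$ lies in the $C^r$-closure of the set of lightlike incomplete Lorentzian metrics on $T^2$. Every flat Lorentzian metric on $T^2$ lies in the $C^r$-closure of the set of Lorentzian metrics on $T^2$ that are simultaneously timelike, lightlike and spacelike incomplete. -/

import Mathlib

open scoped ContDiff Topology UniformConvergence

noncomputable section

namespace LorentzTorus

/-- The torus `T² = (ℝ/ℤ)²`. -/
abbrev Torus : Type := UnitAddTorus (Fin 2)

/-- `ℝ²`, which is both the universal covering of `T²` and, by means of the global frame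
`∂₀, ∂₁` of coordinate vector fields, the tangent space of `T²` at each of its points. -/
abbrev Plane : Type := Fin 2 → ℝ

/-- The covering map `ℝ² → T²`; its local inverses are the charts of `T²`. -/
def proj (p : Plane) : Torus := fun i => (p i : UnitAddCircle)

/-- A function on `T²` is smooth if its lift to `ℝ²` is. -/
def IsSmooth (f : Torus → ℝ) : Prop := ContDiff ℝ ∞ (fun p : Plane => f (proj p))

/-- The derivative `∂ᵢ f` of a function on `T²` in the direction of the `i`-th coordinate field. -/
def partialDeriv (i : Fin 2) (f : Torus → ℝ) (x : Torus) : ℝ :=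
  deriv (fun s : ℝ => f (x + proj (Pi.single i s))) 0

/-- A smooth Lorentzian metric on `T²`, given by its components `g i j = g(∂ᵢ, ∂ⱼ)`.
A symmetric bilinear form on a plane is nondegenerate of index one iff its Gram determinant
is negative. -/
structure LorentzMetric where
  /-- the matrix of components at each point -/
  comp : Torus → Matrix (Fin 2) (Fin 2) ℝ
  smooth : ∀ i j, IsSmooth (fun x => comp x i j)
  symm : ∀ x, (comp x).IsSymm
  lorentzian : ∀ x, (comp x).det < 0

namespace LorentzMetric

/-- The scalar product `g_x(u, w)` of two tangent vectors at `x`. -/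
def inner (g : LorentzMetric) (x : Torus) (u w : Plane) : ℝ :=
  ∑ i, ∑ j, g.comp x i j * u i * w j

/-- The Christoffel symbols `Γᵏᵢⱼ` of the Levi-Civita connection. -/
def christoffel (g : LorentzMetric) (k i j : Fin 2) (x : Torus) : ℝ :=
  (1 / 2) * ∑ l, (g.comp x)⁻¹ k l *
    (partialDeriv i (fun y => g.comp y j l) x + partialDeriv j (fun y => g.comp y i l) x
      - partialDeriv l (fun y => g.comp y i j) x)

/-- The components of the curvature tensor: the `∂ₗ`-component of `R(∂ᵢ, ∂ⱼ)∂ₖ`, with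
`R(X, Y) = [∇_X, ∇_Y] - ∇_[X,Y]`. -/
def curvature (g : LorentzMetric) (l k i j : Fin 2) (x : Torus) : ℝ :=
  partialDeriv i (g.christoffel l j k) x - partialDeriv j (g.christoffel l i k) x
    + ∑ m, (g.christoffel l i m x * g.christoffel m j k x
      - g.christoffel l j m x * g.christoffel m i k x)

/-- A metric is flat if its curvature tensor vanishes. -/
def IsFlat (g : LorentzMetric) : Prop := ∀ l k i j x, g.curvature l k i j x = 0

/-- `h = Ω g` for some smooth function `Ω > 0` on the torus. -/
def IsConformalTo (h g : LorentzMetric) : Prop :=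
  ∃ Ω : Torus → ℝ, IsSmooth Ω ∧ (∀ x, 0 < Ω x) ∧ ∀ x, h.comp x = Ω x • g.comp x

/-- Globally conformal to a flat Lorentzian metric on the torus. -/
def IsConformallyFlat (g : LorentzMetric) : Prop :=
  ∃ g₀ : LorentzMetric, g₀.IsFlat ∧ g.IsConformalTo g₀

/-- The components `(L_K g)(∂ᵢ, ∂ⱼ)` of the Lie derivative of the metric. -/
def lieDeriv (g : LorentzMetric) (K : Torus → Plane) (i j : Fin 2) (x : Torus) : ℝ :=
  ∑ k, (K x k * partialDeriv k (fun y => g.comp y i j) x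
    + g.comp x k j * partialDeriv i (fun y => K y k) x
    + g.comp x i k * partialDeriv j (fun y => K y k) x)

/-- `K` is a smooth conformal (Killing) vector field: `L_K g = 2 σ g` for a smooth `σ`. -/
def IsConformalField (g : LorentzMetric) (K : Torus → Plane) : Prop :=
  (∀ k, IsSmooth (fun x => K x k)) ∧
    ∃ σ : Torus → ℝ, IsSmooth σ ∧ ∀ i j x, g.lieDeriv K i j x = 2 * σ x * g.comp x i j

/-- The tangent vector `v` at `x` is timelike. -/
def IsTimelike (g : LorentzMetric) (x : Torus) (v : Plane) : Prop := g.inner x v v < 0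

/-- The tangent vector `v` at `x` is spacelike. -/
def IsSpacelike (g : LorentzMetric) (x : Torus) (v : Plane) : Prop := 0 < g.inner x v v

/-- The tangent vector `v` at `x` is lightlike. -/
def IsLightlike (g : LorentzMetric) (x : Torus) (v : Plane) : Prop := g.inner x v v = 0 ∧ v ≠ 0

end LorentzMetric

/-- The curve `γ` in the torus is differentiable at `t` with velocity `v`: near `t` it is the
projection of a curve in `ℝ²` with derivative `v` at `t`. -/
def HasVelocityAt (γ : ℝ → Torus) (v : Plane) (t : ℝ) : Prop :=
  ∃ c : ℝ → Plane, HasDerivAt c v t ∧ ∀ᶠ s in 𝓝 t, proj (c s) = γ s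

namespace LorentzMetric

/-- On the (open) set `I` of parameters, `γ` is a geodesic with velocity `v`, that is,
`γ' = v` and `Dv/dt = 0`. -/
def IsGeodesicOn (g : LorentzMetric) (γ : ℝ → Torus) (v : ℝ → Plane) (I : Set ℝ) : Prop :=
  ∀ t ∈ I, HasVelocityAt γ (v t) t ∧
    ∀ k, HasDerivAt (fun s => v s k)
      (-∑ i, ∑ j, g.christoffel k i j (γ t) * v t i * v t j) t

/-- The curve `γ`, restricted to `I`, extends to a geodesic defined on the whole real line. -/
def ExtendsToLine (g : LorentzMetric) (γ : ℝ → Torus) (I : Set ℝ) : Prop :=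
  ∃ (γ' : ℝ → Torus) (v' : ℝ → Plane), g.IsGeodesicOn γ' v' Set.univ ∧ Set.EqOn γ' γ I

/-- Geodesic completeness: every geodesic on an open interval extends to the whole line. -/
def IsComplete (g : LorentzMetric) : Prop :=
  ∀ (I : Set ℝ) (γ : ℝ → Torus) (v : ℝ → Plane), IsOpen I → I.OrdConnected → I.Nonempty →
    g.IsGeodesicOn γ v I → g.ExtendsToLine γ I

/-- Some geodesic whose velocity is everywhere of the causal type `C` does not extend to the
whole line. -/
def IsIncompleteFor (g : LorentzMetric) (C : Torus → Plane → Prop) : Prop :=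
  ∃ (I : Set ℝ) (γ : ℝ → Torus) (v : ℝ → Plane), IsOpen I ∧ I.OrdConnected ∧ I.Nonempty ∧
    g.IsGeodesicOn γ v I ∧ (∀ t ∈ I, C (γ t) (v t)) ∧ ¬ g.ExtendsToLine γ I

/-- Timelike incompleteness. -/
def IsTimelikeIncomplete (g : LorentzMetric) : Prop := g.IsIncompleteFor g.IsTimelike

/-- Lightlike incompleteness. -/
def IsLightlikeIncomplete (g : LorentzMetric) : Prop := g.IsIncompleteFor g.IsLightlike

/-- Spacelike incompleteness. -/
def IsSpacelikeIncomplete (g : LorentzMetric) : Prop := g.IsIncompleteFor g.IsSpacelike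

/-- The `k`-th total derivative of the component `g i j` (lifted to `ℝ²`), as an element of a
function space with the topology of uniform convergence. -/
def jet (g : LorentzMetric) (k : ℕ) (i j : Fin 2) :
    Plane →ᵤ ContinuousMultilinearMap ℝ (fun _ : Fin k => Plane) ℝ :=
  UniformFun.ofFun (iteratedFDeriv ℝ k (fun p : Plane => g.comp (proj p) i j))

/-- The `C^r` topology (`0 ≤ r ≤ ∞`) on the set of Lorentzian metrics of the torus: uniform
convergence of the components with all their derivatives of order at most `r`. -/
@[reducible] def crTopology (r : ℕ∞) : TopologicalSpace LorentzMetric :=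
  TopologicalSpace.induced
    (fun g (k : {k : ℕ // (k : ℕ∞) ≤ r}) (i j : Fin 2) => g.jet k i j) inferInstance

end LorentzMetric

end LorentzTorus

end

/-!
A flat metric lifts to `a ⊗ b + b ⊗ a` on the plane with `a = dξ` and `b = dη` parallel, and a deck
transformation multiplies `a` and `b` by constants `c` and `c⁻¹`. If some `c` were not `1`, the
constants of `ξ` and `η` could be chosen such that `ξ η` is invariant. The critical points of `ξ η`
are zeros, so, attaining its extrema, it would vanish identically, against the independence of `dξ`
and `dη`. Hence the conformally flat metrics are the metrics `Ω (a ⊗ b + b ⊗ a)` with closed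
one-forms `a` and `b` on the torus. The fields on which `a` and `b` are constant are conformal.
Conversely, after a conformal change a conformal field `K` with `g(K, K) ≠ 0` is a Killing field of
constant length, and then `g(K, ·)` and `vol(K, ·)` are closed, with null sum and difference.

Along a geodesic `c` let `P` and `Q` be `Ω` times `a(c')` and `b(c')`, up to order. The conserved
energy is `P Q / Ω`, and once it is treated as a constant the geodesic equation is affine in
`(P, Q)`, which gives completeness.

For the incomplete metrics, `a` is perturbed to have commensurable periods; a multiple of it is
then `du` for a function `u` whose periods are integers. In the metric
`a ⊗ B + B ⊗ a + κ φ(u) B ⊗ B`, where `B = Ω b` and `φ(u) = sin (π u) cos³ (π u)`, the geodesics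
orthogonal to the kernel of `a` can be found explicitly: `u = arctan (s t²) / π` up to the choice of
`s`, which determines the causal character, while `B(c')` blows up like `1 / t`.
-/

open scoped ContDiff Topology UniformConvergence

noncomputable section

namespace LorentzTorus

/-! ### Calculus on the plane and the torus -/

section Plane

/-- The partial derivative `∂ᵢ F` of a function on the plane; it is `0` where `F` is not
differentiable. -/
def pderiv (i : Fin 2) (F : Plane → ℝ) (p : Plane) : ℝ := fderiv ℝ F p (Pi.single i 1)

/-- The determinant of two vectors of the plane. Applied to two one-forms, it is the coefficient of
their exterior product. -/
def wedge (u w : Plane) : ℝ := u 0 * w 1 - u 1 * w 0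

theorem eq_zero_of_wedge_eq_zero {u w v : Plane} (huw : wedge u w ≠ 0) (hu : wedge v u = 0)
    (hw : wedge v w = 0) : v = 0 := by
  unfold wedge at huw hu hw
  refine funext (Fin.forall_fin_two.2 ⟨mul_right_cancel₀ huw ?_, mul_right_cancel₀ huw ?_⟩)
  · simp only [Pi.zero_apply]; linear_combination u 0 * hw - w 0 * hu
  · simp only [Pi.zero_apply]; linear_combination u 1 * hw - w 1 * hu

theorem eq_zero_of_dotProduct_eq_zero {u w v : Plane} (huw : wedge u w ≠ 0) (hu : v ⬝ᵥ u = 0)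
    (hw : v ⬝ᵥ w = 0) : v = 0 := by
  simp only [dotProduct, Fin.sum_univ_two] at hu hw
  unfold wedge at huw
  refine funext (Fin.forall_fin_two.2 ⟨mul_right_cancel₀ huw ?_, mul_right_cancel₀ huw ?_⟩)
  · simp only [Pi.zero_apply]; linear_combination w 1 * hu - u 1 * hw
  · simp only [Pi.zero_apply]; linear_combination u 0 * hw - w 0 * hu

variable {F G : Plane → ℝ} {p : Plane}

theorem fderiv_eq_sum_pderiv (F : Plane → ℝ) (p v : Plane) :
    fderiv ℝ F p v = ∑ i, pderiv i F p * v i := by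
  conv_lhs => rw [pi_eq_sum_univ' v]
  simp only [map_sum, map_smul, smul_eq_mul, pderiv, mul_comm]

theorem hasDerivAt_comp_curve {c : ℝ → Plane} {v : Plane} {t : ℝ}
    (hF : DifferentiableAt ℝ F (c t)) (hc : HasDerivAt c v t) :
    HasDerivAt (fun s => F (c s)) (∑ i, pderiv i F (c t) * v i) t := by
  rw [← fderiv_eq_sum_pderiv]
  exact hF.hasFDerivAt.comp_hasDerivAt t hc

theorem contDiff_pderiv (hF : ContDiff ℝ ∞ F) (i : Fin 2) : ContDiff ℝ ∞ (pderiv i F) :=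
  (hF.fderiv_right (by simp)).clm_apply contDiff_const

theorem pderiv_add (hF : DifferentiableAt ℝ F p) (hG : DifferentiableAt ℝ G p) (i : Fin 2) :
    pderiv i (fun q => F q + G q) p = pderiv i F p + pderiv i G p := by
  simp only [pderiv, fderiv_fun_add hF hG, add_apply]

theorem pderiv_sub (hF : DifferentiableAt ℝ F p) (hG : DifferentiableAt ℝ G p) (i : Fin 2) :
    pderiv i (fun q => F q - G q) p = pderiv i F p - pderiv i G p := by
  simp only [pderiv, fderiv_fun_sub hF hG, sub_apply]

theorem pderiv_mul (hF : DifferentiableAt ℝ F p) (hG : DifferentiableAt ℝ G p) (i : Fin 2) :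
    pderiv i (fun q => F q * G q) p = pderiv i F p * G p + F p * pderiv i G p := by
  simp only [pderiv, fderiv_fun_mul hF hG, add_apply,
    smul_apply, smul_eq_mul]
  ring

theorem pderiv_const (a : ℝ) (i : Fin 2) : pderiv i (fun _ => a) p = 0 := by
  simp [pderiv]

theorem pderiv_const_mul (hF : DifferentiableAt ℝ F p) (a : ℝ) (i : Fin 2) :
    pderiv i (fun q => a * F q) p = a * pderiv i F p := by
  rw [pderiv_mul (differentiableAt_const a) hF, pderiv_const, zero_mul, zero_add]

theorem pderiv_comp {φ : ℝ → ℝ} {φ' : ℝ} (hφ : HasDerivAt φ φ' (F p))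
    (hF : DifferentiableAt ℝ F p) (i : Fin 2) :
    pderiv i (fun q => φ (F q)) p = φ' * pderiv i F p :=
  congrArg (· (Pi.single i 1)) (hφ.comp_hasFDerivAt p hF.hasFDerivAt).fderiv

theorem pderiv_comm (hF : ContDiff ℝ ∞ F) (i j : Fin 2) (p : Plane) :
    pderiv i (pderiv j F) p = pderiv j (pderiv i F) p := by
  have pderiv_pderiv (i j : Fin 2) : pderiv i (pderiv j F) p
      = fderiv ℝ (fderiv ℝ F) p (Pi.single i 1) (Pi.single j 1) := by
    have hd : DifferentiableAt ℝ (fderiv ℝ F) p :=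
      (hF.fderiv_right (m := ∞) (by simp)).differentiable (by simp) p
    have h := fderiv_clm_apply hd (differentiableAt_const (Pi.single j 1 : Plane))
    simpa using! congrArg (· (Pi.single i 1)) h
  rw [pderiv_pderiv, pderiv_pderiv]
  exact (hF.contDiffAt.isSymmSndFDerivAt (by simpa using ENat.LEInfty.out)).eq _ _

theorem pderiv_comp_add_right (F : Plane → ℝ) (n : Plane) (i : Fin 2) (p : Plane) :
    pderiv i (fun q => F (q + n)) p = pderiv i F (p + n) := by
  simp only [pderiv, fderiv_comp_add_right]

theorem eq_of_pderiv_eq_zero (hF : Differentiable ℝ F) (h : ∀ i p, pderiv i F p = 0)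
    (p q : Plane) : F p = F q :=
  is_const_of_fderiv_eq_zero hF (fun p => by
    ext v; simp only [fderiv_eq_sum_pderiv, h, zero_mul, Finset.sum_const_zero]; rfl) p q

theorem exists_eq_add_const (hF : Differentiable ℝ F) (hG : Differentiable ℝ G)
    (h : ∀ i p, pderiv i F p = pderiv i G p) : ∃ c, ∀ p, F p = G p + c := by
  refine ⟨F 0 - G 0, fun p => sub_eq_iff_eq_add'.1 ?_⟩
  refine eq_of_pderiv_eq_zero (hF.sub hG) (fun i q => ?_) p 0
  exact (pderiv_sub (hF q) (hG q) i).trans (sub_eq_zero.2 (h i q))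

end Plane

section Covering

theorem proj_add (p q : Plane) : proj (p + q) = proj p + proj q := rfl

theorem proj_surjective : Function.Surjective proj := fun x =>
  ⟨fun i => (x i).out, funext fun i => Quotient.out_eq (x i)⟩

theorem proj_add_eq_self {n : Plane} (hn : proj n = 0) (p : Plane) : proj (p + n) = proj p := by
  rw [proj_add, hn, add_zero]

theorem proj_eq_iff {p q : Plane} : proj p = proj q ↔ proj (p - q) = 0 :=
  (sub_eq_zero (a := proj p) (b := proj q)).symm

theorem proj_eq_zero_iff {n : Plane} : proj n = 0 ↔ ∀ i, ∃ z : ℤ, n i = z := by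
  simp only [funext_iff, proj, Pi.zero_apply, AddCircle.coe_eq_zero_iff, zsmul_eq_mul, mul_one,
    eq_comm (a := n _)]

theorem isOpenQuotientMap_proj : IsOpenQuotientMap proj :=
  IsOpenQuotientMap.piMap fun _ => QuotientAddGroup.isOpenQuotientMap_mk

theorem exists_descent {X : Type*} {F : Plane → X} (hF : ∀ p n, proj n = 0 → F (p + n) = F p) :
    ∃ f : Torus → X, ∀ p, f (proj p) = F p := by
  refine ⟨fun x => F (Function.surjInv proj_surjective x), fun p => ?_⟩
  have h : proj (Function.surjInv proj_surjective (proj p)) = proj p :=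
    Function.surjInv_eq proj_surjective (proj p)
  simpa using hF p _ (proj_eq_iff.1 h)

end Covering

theorem IsSmooth.differentiableAt {f : Torus → ℝ} (hf : IsSmooth f) (p : Plane) :
    DifferentiableAt ℝ (fun q => f (proj q)) p := ContDiff.differentiable hf (by simp) p

theorem partialDeriv_proj {f : Torus → ℝ} (hf : IsSmooth f) (i : Fin 2) (p : Plane) :
    partialDeriv i f (proj p) = pderiv i (fun q => f (proj q)) p := by
  have h_line : HasDerivAt (fun s : ℝ => p + Pi.single i s) (Pi.single i 1) 0 :=
    (hasDerivAt_single i 0).const_add p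
  have h_lift : HasFDerivAt (fun q => f (proj q)) (fderiv ℝ (fun q => f (proj q)) p)
      (p + Pi.single i (0 : ℝ)) := by
    simpa using (hf.differentiableAt p).hasFDerivAt
  exact (h_lift.comp_hasDerivAt (0 : ℝ) h_line).deriv

namespace IsSmooth

variable {f h : Torus → ℝ}

theorem const (a : ℝ) : IsSmooth (fun _ => a) := contDiff_const

theorem add (hf : IsSmooth f) (hh : IsSmooth h) : IsSmooth (fun x => f x + h x) :=
  ContDiff.add hf hh

theorem sub (hf : IsSmooth f) (hh : IsSmooth h) : IsSmooth (fun x => f x - h x) :=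
  ContDiff.sub hf hh

theorem neg (hf : IsSmooth f) : IsSmooth (fun x => - f x) := ContDiff.neg hf

theorem mul (hf : IsSmooth f) (hh : IsSmooth h) : IsSmooth (fun x => f x * h x) :=
  ContDiff.mul hf hh

theorem sum {f : Fin 2 → Torus → ℝ} (hf : ∀ i, IsSmooth (f i)) :
    IsSmooth (fun x => ∑ i, f i x) := ContDiff.sum fun i _ => hf i

theorem inv (hf : IsSmooth f) (h0 : ∀ x, f x ≠ 0) : IsSmooth (fun x => (f x)⁻¹) :=
  ContDiff.inv hf fun _ => h0 _

theorem div (hf : IsSmooth f) (hh : IsSmooth h) (h0 : ∀ x, h x ≠ 0) :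
    IsSmooth (fun x => f x / h x) := ContDiff.div hf hh fun _ => h0 _

theorem sqrt (hf : IsSmooth f) (h0 : ∀ x, f x ≠ 0) : IsSmooth (fun x => √(f x)) :=
  ContDiff.sqrt hf fun _ => h0 _

theorem partialDeriv (hf : IsSmooth f) (i : Fin 2) : IsSmooth (partialDeriv i f) := by
  simpa only [IsSmooth, partialDeriv_proj hf] using contDiff_pderiv hf i

theorem continuous (hf : IsSmooth f) : Continuous f :=
  isOpenQuotientMap_proj.isQuotientMap.continuous_iff.2 (ContDiff.continuous hf)

theorem exists_abs_le (hf : IsSmooth f) : ∃ M, 0 ≤ M ∧ ∀ x, |f x| ≤ M := by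
  obtain ⟨M, hM⟩ := (isCompact_range hf.continuous).isBounded.exists_norm_le
  exact ⟨max M 0, le_max_right _ _, fun x => (hM _ ⟨x, rfl⟩).trans (le_max_left _ _)⟩

end IsSmooth

theorem isSmooth_wedge {a b : Torus → Plane} (ha : ∀ i, IsSmooth fun x => a x i)
    (hb : ∀ i, IsSmooth fun x => b x i) : IsSmooth fun x => wedge (a x) (b x) :=
  ((ha 0).mul (hb 1)).sub ((ha 1).mul (hb 0))

section PartialDeriv

variable {f h : Torus → ℝ}

theorem partialDeriv_add (hf : IsSmooth f) (hh : IsSmooth h) (i : Fin 2) (x : Torus) :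
    partialDeriv i (fun y => f y + h y) x = partialDeriv i f x + partialDeriv i h x := by
  obtain ⟨p, rfl⟩ := proj_surjective x
  simp only [partialDeriv_proj (hf.add hh), partialDeriv_proj hf, partialDeriv_proj hh]
  exact pderiv_add (hf.differentiableAt p) (hh.differentiableAt p) i

theorem partialDeriv_sub (hf : IsSmooth f) (hh : IsSmooth h) (i : Fin 2) (x : Torus) :
    partialDeriv i (fun y => f y - h y) x = partialDeriv i f x - partialDeriv i h x := by
  obtain ⟨p, rfl⟩ := proj_surjective x
  simp only [partialDeriv_proj (hf.sub hh), partialDeriv_proj hf, partialDeriv_proj hh]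
  exact pderiv_sub (hf.differentiableAt p) (hh.differentiableAt p) i

theorem partialDeriv_mul (hf : IsSmooth f) (hh : IsSmooth h) (i : Fin 2) (x : Torus) :
    partialDeriv i (fun y => f y * h y) x
      = partialDeriv i f x * h x + f x * partialDeriv i h x := by
  obtain ⟨p, rfl⟩ := proj_surjective x
  simp only [partialDeriv_proj (hf.mul hh), partialDeriv_proj hf, partialDeriv_proj hh]
  exact pderiv_mul (hf.differentiableAt p) (hh.differentiableAt p) i

theorem partialDeriv_const (a : ℝ) (i : Fin 2) (x : Torus) :
    partialDeriv i (fun _ => a) x = 0 := by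
  simp [partialDeriv]

theorem partialDeriv_const_mul (hf : IsSmooth f) (a : ℝ) (i : Fin 2) (x : Torus) :
    partialDeriv i (fun y => a * f y) x = a * partialDeriv i f x := by
  rw [partialDeriv_mul (IsSmooth.const a) hf, partialDeriv_const, zero_mul, zero_add]

theorem partialDeriv_neg (hf : IsSmooth f) (i : Fin 2) (x : Torus) :
    partialDeriv i (fun y => - f y) x = - partialDeriv i f x := by
  simpa using partialDeriv_const_mul hf (-1) i x

end PartialDeriv

namespace LorentzMetric

variable (g : LorentzMetric)

theorem comp_symm (x : Torus) (i j : Fin 2) : g.comp x i j = g.comp x j i := (g.symm x).apply j i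

theorem det_comp (x : Torus) :
    (g.comp x).det = g.comp x 0 0 * g.comp x 1 1 - g.comp x 0 1 * g.comp x 0 1 := by
  rw [Matrix.det_fin_two, g.comp_symm x 1 0]

theorem det_comp_smooth : IsSmooth (fun x => (g.comp x).det) := by
  simp only [Matrix.det_fin_two]
  exact ((g.smooth 0 0).mul (g.smooth 1 1)).sub ((g.smooth 0 1).mul (g.smooth 1 0))

theorem inv_comp_smooth (i j : Fin 2) : IsSmooth (fun x => (g.comp x)⁻¹ i j) := by
  have hadj : IsSmooth (fun x => (g.comp x).adjugate i j) := by
    simp only [Matrix.adjugate_fin_two]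
    fin_cases i <;> fin_cases j
    exacts [g.smooth 1 1, (g.smooth 0 1).neg, (g.smooth 1 0).neg, g.smooth 0 0]
  simp only [Matrix.inv_def, Ring.inverse_eq_inv', Matrix.smul_apply, smul_eq_mul]
  exact (g.det_comp_smooth.inv fun x => (g.lorentzian x).ne).mul hadj

theorem christoffel_symm (k i j : Fin 2) (x : Torus) :
    g.christoffel k i j x = g.christoffel k j i x := by
  simp only [christoffel, g.comp_symm _ j i]
  exact congrArg _ (Finset.sum_congr rfl fun l _ => by ring)

theorem christoffel_smooth (k i j : Fin 2) : IsSmooth (g.christoffel k i j) :=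
  (IsSmooth.const _).mul <| IsSmooth.sum fun l => (g.inv_comp_smooth k l).mul <|
    (((g.smooth j l).partialDeriv i).add ((g.smooth i l).partialDeriv j)).sub
      ((g.smooth i j).partialDeriv l)

theorem sum_comp_mul_christoffel (l i j : Fin 2) (x : Torus) :
    ∑ k, g.comp x l k * g.christoffel k i j x = (1 / 2) *
      (partialDeriv i (fun y => g.comp y j l) x + partialDeriv j (fun y => g.comp y i l) x
        - partialDeriv l (fun y => g.comp y i j) x) := by
  set A : Plane := fun m =>
    partialDeriv i (fun y => g.comp y j m) x + partialDeriv j (fun y => g.comp y i m) x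
      - partialDeriv m (fun y => g.comp y i j) x
  have hinv : g.comp x * (g.comp x)⁻¹ = 1 :=
    Matrix.mul_nonsing_inv _ (isUnit_iff_ne_zero.2 (g.lorentzian x).ne)
  have hΓ : (fun k => g.christoffel k i j x) = (1 / 2 : ℝ) • (g.comp x)⁻¹.mulVec A := rfl
  have hlower : (g.comp x).mulVec (fun k => g.christoffel k i j x) = (1 / 2 : ℝ) • A := by
    rw [hΓ, Matrix.mulVec_smul, Matrix.mulVec_mulVec, hinv, Matrix.one_mulVec]
  exact congrFun hlower l

theorem partialDeriv_comp (l i j : Fin 2) (x : Torus) :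
    partialDeriv l (fun y => g.comp y i j) x =
      ∑ k, g.christoffel k l i x * g.comp x k j + ∑ k, g.christoffel k l j x * g.comp x i k := by
  have hi := g.sum_comp_mul_christoffel j l i x
  have hj := g.sum_comp_mul_christoffel i l j x
  simp only [mul_comm (g.comp x _ _), g.comp_symm x j] at hi hj
  rw [hi, hj]
  simp only [g.comp_symm _ j]
  ring

/-- The component `(∇ₗ a)ᵢ` of the covariant derivative of a one-form on the universal covering,
with respect to the lifted metric. -/
def covDeriv (a : Plane → Plane) (l i : Fin 2) (p : Plane) : ℝ :=
  pderiv l (fun q => a q i) p - ∑ k, g.christoffel k l i (proj p) * a p k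

variable {g}

theorem covDeriv_sub_covDeriv_swap (a : Plane → Plane) (i j : Fin 2) (p : Plane) :
    g.covDeriv a i j p - g.covDeriv a j i p
      = pderiv i (fun q => a q j) p - pderiv j (fun q => a q i) p := by
  simp only [covDeriv, g.christoffel_symm _ i j]
  ring

/-- Commuting the second partial derivatives of `a` leaves the curvature on one side and the
differential of the connection form `ν` on the other. -/
theorem sum_curvature_mul_of_recurrent {a ν : Plane → Plane} (ha : ContDiff ℝ ∞ a)
    (hν : ContDiff ℝ ∞ ν) (hrec : ∀ p l i, g.covDeriv a l i p = ν p l * a p i)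
    (k i j : Fin 2) (p : Plane) :
    ∑ l, g.curvature l k i j (proj p) * a p l
      = (pderiv j (fun q => ν q i) p - pderiv i (fun q => ν q j) p) * a p k := by
  have hdiff {b : Plane → Plane} (hb : ContDiff ℝ ∞ b) (i : Fin 2) :
      Differentiable ℝ fun p => b p i :=
    (contDiff_pi.1 hb i).differentiable (by simp)
  have hΓ (k l i : Fin 2) := (g.christoffel_smooth k l i).differentiableAt p
  have hpderiv (l i : Fin 2) : pderiv l (fun q => a q i) = fun p =>
      (g.christoffel 0 l i (proj p) * a p 0 + g.christoffel 1 l i (proj p) * a p 1)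
        + ν p l * a p i := by
    funext p
    have := hrec p l i
    simp only [covDeriv, Fin.sum_univ_two] at this
    linear_combination this
  have hsecond (m l : Fin 2) : pderiv m (pderiv l fun q => a q k) p =
      pderiv m (fun q => g.christoffel 0 l k (proj q)) p * a p 0
        + g.christoffel 0 l k (proj p) * pderiv m (fun q => a q 0) p
        + (pderiv m (fun q => g.christoffel 1 l k (proj q)) p * a p 1
        + g.christoffel 1 l k (proj p) * pderiv m (fun q => a q 1) p)
        + (pderiv m (fun q => ν q l) p * a p k + ν p l * pderiv m (fun q => a q k) p) := by
    have h0 := (hΓ 0 l k).fun_mul (hdiff ha 0 p)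
    have h1 := (hΓ 1 l k).fun_mul (hdiff ha 1 p)
    have h2 := (hdiff hν l p).fun_mul (hdiff ha k p)
    rw [hpderiv, pderiv_add (h0.fun_add h1) h2, pderiv_add h0 h1,
      pderiv_mul (hΓ 0 l k) (hdiff ha 0 p), pderiv_mul (hΓ 1 l k) (hdiff ha 1 p),
      pderiv_mul (hdiff hν l p) (hdiff ha k p)]
  have hcomm := pderiv_comm (contDiff_pi.1 ha k) i j p
  simp only [hsecond] at hcomm
  simp only [hpderiv] at hcomm
  simp only [curvature, Fin.sum_univ_two, partialDeriv_proj (g.christoffel_smooth _ _ _)]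
  linear_combination hcomm

theorem isFlat_of_parallel {a b : Plane → Plane} (ha : ContDiff ℝ ∞ a) (hb : ContDiff ℝ ∞ b)
    (hab : ∀ p, wedge (a p) (b p) ≠ 0) (ha_par : ∀ p l i, g.covDeriv a l i p = 0)
    (hb_par : ∀ p l i, g.covDeriv b l i p = 0) : g.IsFlat := by
  have curvature_parallel {c : Plane → Plane} (hc : ContDiff ℝ ∞ c)
      (hpar : ∀ p l i, g.covDeriv c l i p = 0) (k i j : Fin 2) (p : Plane) :
      (fun l => g.curvature l k i j (proj p)) ⬝ᵥ c p = 0 := by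
    refine (sum_curvature_mul_of_recurrent (ν := 0) hc contDiff_const (by simp [hpar])
      k i j p).trans ?_
    simp [pderiv_const]
  intro l k i j x
  obtain ⟨p, rfl⟩ := proj_surjective x
  exact congrFun (eq_zero_of_dotProduct_eq_zero (hab p) (curvature_parallel ha ha_par k i j p)
    (curvature_parallel hb hb_par k i j p)) l

end LorentzMetric

/-! ### Null coframes -/

/-- A smooth closed one-form on the torus. -/
structure IsClosedForm (a : Torus → Plane) : Prop where
  smooth : ∀ i, IsSmooth fun x => a x i
  closed : ∀ x, partialDeriv 0 (fun y => a y 1) x = partialDeriv 1 (fun y => a y 0) x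

namespace IsClosedForm

variable {a b : Torus → Plane}

theorem contDiff (ha : IsClosedForm a) : ContDiff ℝ ∞ fun p => a (proj p) :=
  contDiff_pi.2 ha.smooth

theorem partialDeriv_comm (ha : IsClosedForm a) (i j : Fin 2) (x : Torus) :
    partialDeriv i (fun y => a y j) x = partialDeriv j (fun y => a y i) x := by
  fin_cases i <;> fin_cases j
  exacts [rfl, ha.closed x, (ha.closed x).symm, rfl]

theorem pderiv_comm (ha : IsClosedForm a) (i j : Fin 2) (p : Plane) :
    pderiv i (fun q => a (proj q) j) p = pderiv j (fun q => a (proj q) i) p := by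
  rw [← partialDeriv_proj (ha.smooth j), ← partialDeriv_proj (ha.smooth i)]
  exact ha.partialDeriv_comm i j _

theorem add (ha : IsClosedForm a) (hb : IsClosedForm b) : IsClosedForm (fun x => a x + b x) where
  smooth i := (ha.smooth i).add (hb.smooth i)
  closed x := by
    simp only [Pi.add_apply, partialDeriv_add (ha.smooth _) (hb.smooth _), ha.closed, hb.closed]

theorem const_smul (ha : IsClosedForm a) (r : ℝ) : IsClosedForm (fun x => r • a x) where
  smooth i := (IsSmooth.const r).mul (ha.smooth i)
  closed x := by
    simp only [Pi.smul_apply, smul_eq_mul, partialDeriv_const_mul (ha.smooth _), ha.closed]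

theorem const (u : Plane) : IsClosedForm (fun _ => u) where
  smooth _ := IsSmooth.const _
  closed _ := by simp only [partialDeriv_const]

end IsClosedForm

namespace LorentzMetric

/-- The lift of the metric to the universal covering is the symmetric product `a ⊗ b + b ⊗ a` of
two smooth one-forms, which are then null for it. -/
structure IsLiftedNullCoframe (g : LorentzMetric) (a b : Plane → Plane) : Prop where
  contDiff_left : ContDiff ℝ ∞ a
  contDiff_right : ContDiff ℝ ∞ b
  comp_eq : ∀ p i j, g.comp (proj p) i j = a p i * b p j + a p j * b p i

/-- The metric is `Ω` times the symmetric product of the closed one-forms `a` and `b`. -/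
structure IsNullCoframe (g : LorentzMetric) (Ω : Torus → ℝ) (a b : Torus → Plane) : Prop where
  smooth : IsSmooth Ω
  pos : ∀ x, 0 < Ω x
  left : IsClosedForm a
  right : IsClosedForm b
  comp_eq : ∀ x i j, g.comp x i j = Ω x * (a x i * b x j + a x j * b x i)

theorem wedge_ne_zero_of_comp_eq {g : LorentzMetric} {x : Torus} {c : ℝ} {u w : Plane}
    (h : ∀ i j, g.comp x i j = c * (u i * w j + u j * w i)) : wedge u w ≠ 0 := by
  intro h0
  have hdet : (g.comp x).det = -(c * wedge u w) ^ 2 := by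
    simp only [g.det_comp, h, wedge]
    ring
  exact (g.lorentzian x).ne (by rw [hdet, h0]; ring)

/-- Contracting the hypothesis with the kernels of `a` and `b` shows that `S` is a multiple of `a`
and `T` a multiple of `b`. -/
theorem eq_smul_of_symm_product_eq_zero {a b S T : Plane} (hab : wedge a b ≠ 0)
    (h : ∀ i j, S i * b j + S j * b i + (a i * T j + a j * T i) = 0) :
    S = (wedge S b / wedge a b) • a ∧ T = -(wedge S b / wedge a b) • b := by
  have h00 := h 0 0
  have h01 := h 0 1
  have h11 := h 1 1
  have hS : wedge S a = 0 := by
    apply mul_right_cancel₀ hab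
    unfold wedge
    linear_combination -(a 1 * a 1 / 2) * h00 + a 0 * a 1 * h01 - (a 0 * a 0 / 2) * h11
  have hT : wedge T b = 0 := by
    apply mul_right_cancel₀ hab
    unfold wedge
    linear_combination (b 1 * b 1 / 2) * h00 - b 0 * b 1 * h01 + (b 0 * b 0 / 2) * h11
  have hST : wedge T a = wedge S b := by
    apply mul_right_cancel₀ hab
    unfold wedge
    linear_combination a 1 * b 1 * h00 - (a 0 * b 1 + a 1 * b 0) * h01 + a 0 * b 0 * h11
  constructor
  · refine funext (Fin.forall_fin_two.2 ⟨?_, ?_⟩) <;>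
      simp only [Pi.smul_apply, smul_eq_mul, div_mul_eq_mul_div, eq_div_iff hab] <;>
      unfold wedge at hS ⊢
    · linear_combination -b 0 * hS
    · linear_combination -b 1 * hS
  · rw [← hST]
    refine funext (Fin.forall_fin_two.2 ⟨?_, ?_⟩) <;>
      simp only [Pi.smul_apply, smul_eq_mul, ← neg_div, div_mul_eq_mul_div, eq_div_iff hab] <;>
      unfold wedge at hT ⊢
    · linear_combination a 0 * hT
    · linear_combination a 1 * hT

variable {g : LorentzMetric}

section LiftedNullCoframe

variable {a b : Plane → Plane}

theorem IsLiftedNullCoframe.wedge_ne_zero (h : g.IsLiftedNullCoframe a b) (p : Plane) :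
    wedge (a p) (b p) ≠ 0 :=
  wedge_ne_zero_of_comp_eq (g := g) (x := proj p) (c := 1) fun i j => by rw [h.comp_eq, one_mul]

theorem contDiff_covDeriv (ha : ContDiff ℝ ∞ a) (l i : Fin 2) :
    ContDiff ℝ ∞ (g.covDeriv a l i) :=
  (contDiff_pderiv (contDiff_pi.1 ha i) l).sub <|
    ContDiff.sum fun k _ => ContDiff.mul (g.christoffel_smooth k l i) (contDiff_pi.1 ha k)

theorem IsLiftedNullCoframe.covDeriv_symm_product (h : g.IsLiftedNullCoframe a b) (l i j : Fin 2)
    (p : Plane) : g.covDeriv a l i p * b p j + g.covDeriv a l j p * b p i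
      + (a p i * g.covDeriv b l j p + a p j * g.covDeriv b l i p) = 0 := by
  have ha i := (contDiff_pi.1 h.contDiff_left i).differentiable (by simp) p
  have hb i := (contDiff_pi.1 h.contDiff_right i).differentiable (by simp) p
  have hg := g.partialDeriv_comp l i j (proj p)
  rw [partialDeriv_proj (g.smooth i j)] at hg
  simp only [h.comp_eq] at hg
  rw [pderiv_add ((ha i).fun_mul (hb j)) ((ha j).fun_mul (hb i)), pderiv_mul (ha i) (hb j),
    pderiv_mul (ha j) (hb i)] at hg
  simp only [covDeriv, Fin.sum_univ_two] at hg ⊢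
  linear_combination hg

theorem IsLiftedNullCoframe.exists_connection_form (h : g.IsLiftedNullCoframe a b) :
    ∃ ν : Plane → Plane, ContDiff ℝ ∞ ν ∧ (∀ p l i, g.covDeriv a l i p = ν p l * a p i) ∧
      ∀ p l i, g.covDeriv b l i p = -ν p l * b p i := by
  have ha := contDiff_pi.1 h.contDiff_left
  have hb := contDiff_pi.1 h.contDiff_right
  have hν p l := eq_smul_of_symm_product_eq_zero (S := fun i => g.covDeriv a l i p)
    (T := fun i => g.covDeriv b l i p) (h.wedge_ne_zero p)
    fun i j => h.covDeriv_symm_product l i j p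
  refine ⟨fun p l => wedge (fun i => g.covDeriv a l i p) (b p) / wedge (a p) (b p),
    contDiff_pi.2 fun l => ContDiff.div ?_ ?_ h.wedge_ne_zero,
    fun p l i => congrFun (hν p l).1 i, fun p l i => congrFun (hν p l).2 i⟩
  · exact ((contDiff_covDeriv h.contDiff_left l 0).mul (hb 1)).sub
      ((contDiff_covDeriv h.contDiff_left l 1).mul (hb 0))
  · exact ((ha 0).mul (hb 1)).sub ((ha 1).mul (hb 0))

end LiftedNullCoframe

/-- The metric with components `Ω g`, for a nowhere vanishing function `Ω`. -/
def rescale (g : LorentzMetric) (Ω : Torus → ℝ) (hΩ : IsSmooth Ω) (h0 : ∀ x, Ω x ≠ 0) :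
    LorentzMetric where
  comp x := Ω x • g.comp x
  smooth i j := hΩ.mul (g.smooth i j)
  symm x := (g.symm x).smul _
  lorentzian x := by
    rw [Matrix.det_smul, Fintype.card_fin]
    exact mul_neg_of_pos_of_neg (sq_pos_iff.2 (h0 x)) (g.lorentzian x)

theorem IsConformalTo.isNullCoframe {g₀ : LorentzMetric} {a b : Torus → Plane}
    (h : g.IsConformalTo g₀) (h₀ : g₀.IsNullCoframe (fun _ => 1) a b) :
    ∃ Ω, g.IsNullCoframe Ω a b := by
  obtain ⟨Ω, hΩ, hpos, hg⟩ := h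
  refine ⟨Ω, hΩ, hpos, h₀.left, h₀.right, fun x i j => ?_⟩
  rw [hg, Matrix.smul_apply, smul_eq_mul, h₀.comp_eq, one_mul]

theorem IsFlat.isConformallyFlat (h : g.IsFlat) : g.IsConformallyFlat :=
  ⟨g, h, fun _ => 1, IsSmooth.const 1, fun _ => one_pos, fun _ => (one_smul _ _).symm⟩

namespace IsNullCoframe

variable {Ω : Torus → ℝ} {a b : Torus → Plane}

theorem wedge_ne_zero (h : g.IsNullCoframe Ω a b) (x : Torus) : wedge (a x) (b x) ≠ 0 :=
  wedge_ne_zero_of_comp_eq (h.comp_eq x)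

theorem isLiftedNullCoframe (h : g.IsNullCoframe (fun _ => 1) a b) :
    g.IsLiftedNullCoframe (fun p => a (proj p)) fun p => b (proj p) :=
  ⟨h.left.contDiff, h.right.contDiff, fun p i j => by rw [h.comp_eq, one_mul]⟩

theorem isFlat (h : g.IsNullCoframe (fun _ => 1) a b) : g.IsFlat := by
  have hlift := h.isLiftedNullCoframe
  obtain ⟨ν, -, hνa, hνb⟩ := hlift.exists_connection_form
  -- The connection is torsion-free, so closedness says `ν ∧ a = 0` and `ν ∧ b = 0`.
  have hν p : ν p = 0 := by
    refine eq_zero_of_wedge_eq_zero (h.wedge_ne_zero (proj p)) ?_ ?_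
    · have := g.covDeriv_sub_covDeriv_swap (fun p => a (proj p)) 0 1 p
      rw [hνa, hνa, h.left.pderiv_comm 0 1 p, sub_self] at this
      exact this
    · have := g.covDeriv_sub_covDeriv_swap (fun p => b (proj p)) 0 1 p
      rw [hνb, hνb, h.right.pderiv_comm 0 1 p, sub_self] at this
      unfold wedge
      linear_combination -this
  exact isFlat_of_parallel hlift.contDiff_left hlift.contDiff_right hlift.wedge_ne_zero
    (by simp [hνa, hν]) (by simp [hνb, hν])

theorem isConformallyFlat (h : g.IsNullCoframe Ω a b) : g.IsConformallyFlat := by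
  have h0 x : Ω x ≠ 0 := (h.pos x).ne'
  let g₀ := g.rescale (fun x => (Ω x)⁻¹) (h.smooth.inv h0) fun x => inv_ne_zero (h0 x)
  have h₀ : g₀.IsNullCoframe (fun _ => 1) a b :=
    ⟨IsSmooth.const 1, fun _ => one_pos, h.left, h.right, fun x i j => by
      simp only [g₀, rescale, Matrix.smul_apply, smul_eq_mul, h.comp_eq, one_mul,
        inv_mul_cancel_left₀ (h0 x)]⟩
  exact ⟨g₀, h₀.isFlat, Ω, h.smooth, h.pos, fun x => (smul_inv_smul₀ (h0 x) _).symm⟩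

theorem inner_eq (h : g.IsNullCoframe Ω a b) (x : Torus) (u w : Plane) :
    g.inner x u w = Ω x * ((a x ⬝ᵥ u) * (b x ⬝ᵥ w) + (a x ⬝ᵥ w) * (b x ⬝ᵥ u)) := by
  simp only [inner, dotProduct, Fin.sum_univ_two, h.comp_eq]
  ring

end IsNullCoframe

end LorentzMetric

/-- The vector field on which the one-forms `a` and `b` take the constant values `r` and `s`
(by Cramer's rule, so only where `a` and `b` are independent). -/
def dualField (a b : Torus → Plane) (r s : ℝ) (x : Torus) : Plane :=
  ![(r * b x 1 - s * a x 1) / wedge (a x) (b x), (s * a x 0 - r * b x 0) / wedge (a x) (b x)]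

section DualField

variable {a b : Torus → Plane}

theorem left_dotProduct_dualField {x : Torus} (h : wedge (a x) (b x) ≠ 0) (r s : ℝ) :
    a x ⬝ᵥ dualField a b r s x = r := by
  simp only [dotProduct, Fin.sum_univ_two, dualField, Matrix.cons_val_zero, Matrix.cons_val_one]
  rw [mul_div_assoc', mul_div_assoc', ← add_div, div_eq_iff h, wedge]
  ring

theorem right_dotProduct_dualField {x : Torus} (h : wedge (a x) (b x) ≠ 0) (r s : ℝ) :
    b x ⬝ᵥ dualField a b r s x = s := by
  simp only [dotProduct, Fin.sum_univ_two, dualField, Matrix.cons_val_zero, Matrix.cons_val_one]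
  rw [mul_div_assoc', mul_div_assoc', ← add_div, div_eq_iff h, wedge]
  ring

theorem isSmooth_dualField (ha : ∀ i, IsSmooth fun x => a x i) (hb : ∀ i, IsSmooth fun x => b x i)
    (h : ∀ x, wedge (a x) (b x) ≠ 0) (r s : ℝ) (k : Fin 2) :
    IsSmooth fun x => dualField a b r s x k := by
  have hr := IsSmooth.const r
  have hs := IsSmooth.const s
  have hw := isSmooth_wedge ha hb
  fin_cases k
  · exact ((hr.mul (hb 1)).sub (hs.mul (ha 1))).div hw h
  · exact ((hs.mul (ha 0)).sub (hr.mul (hb 0))).div hw h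

/-- For a closed form `a`, the left-hand side is the component `(L_K a)ᵢ`. -/
theorem sum_mul_partialDeriv_of_dotProduct_const {K : Torus → Plane} {r : ℝ}
    (ha : ∀ i, IsSmooth fun x => a x i) (hK : ∀ i, IsSmooth fun x => K x i)
    (haK : ∀ x, a x ⬝ᵥ K x = r) (i : Fin 2) (x : Torus) :
    ∑ k, (K x k * partialDeriv i (fun y => a y k) x
      + a x k * partialDeriv i (fun y => K y k) x) = 0 := by
  have h := partialDeriv_add ((ha 0).mul (hK 0)) ((ha 1).mul (hK 1)) i x
  have hconst : (fun y => a y 0 * K y 0 + a y 1 * K y 1) = fun _ => r := by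
    funext y
    simpa [dotProduct] using haK y
  rw [hconst, partialDeriv_const, partialDeriv_mul (ha 0) (hK 0),
    partialDeriv_mul (ha 1) (hK 1)] at h
  rw [Fin.sum_univ_two]
  linear_combination -h

end DualField

namespace LorentzMetric.IsNullCoframe

variable {g : LorentzMetric} {Ω : Torus → ℝ} {a b : Torus → Plane}

theorem partialDeriv_comp (h : g.IsNullCoframe Ω a b) (k i j : Fin 2) (x : Torus) :
    partialDeriv k (fun y => g.comp y i j) x
      = partialDeriv k Ω x * (a x i * b x j + a x j * b x i)
        + Ω x * (partialDeriv i (fun y => a y k) x * b x j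
          + a x i * partialDeriv j (fun y => b y k) x
          + (partialDeriv j (fun y => a y k) x * b x i
          + a x j * partialDeriv i (fun y => b y k) x)) := by
  have ha := h.left.smooth
  have hb := h.right.smooth
  simp only [h.comp_eq]
  rw [partialDeriv_mul h.smooth (((ha i).mul (hb j)).add ((ha j).mul (hb i))),
    partialDeriv_add ((ha i).mul (hb j)) ((ha j).mul (hb i)),
    partialDeriv_mul (ha i) (hb j), partialDeriv_mul (ha j) (hb i),
    h.left.partialDeriv_comm k i, h.left.partialDeriv_comm k j,
    h.right.partialDeriv_comm k i, h.right.partialDeriv_comm k j]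

theorem lieDeriv_dualField (h : g.IsNullCoframe Ω a b) (r s : ℝ) (i j : Fin 2) (x : Torus) :
    g.lieDeriv (dualField a b r s) i j x
      = (∑ k, dualField a b r s x k * partialDeriv k Ω x) * (a x i * b x j + a x j * b x i) := by
  have hK := isSmooth_dualField h.left.smooth h.right.smooth h.wedge_ne_zero r s
  have ha := sum_mul_partialDeriv_of_dotProduct_const h.left.smooth hK
    fun x => left_dotProduct_dualField (h.wedge_ne_zero x) r s
  have hb := sum_mul_partialDeriv_of_dotProduct_const h.right.smooth hK
    fun x => right_dotProduct_dualField (h.wedge_ne_zero x) r s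
  simp only [Fin.sum_univ_two] at ha hb
  simp only [lieDeriv, Fin.sum_univ_two, h.partialDeriv_comp]
  simp only [h.comp_eq]
  linear_combination Ω x * b x j * ha i x + Ω x * b x i * ha j x + Ω x * a x j * hb i x
    + Ω x * a x i * hb j x

theorem isConformalField_dualField (h : g.IsNullCoframe Ω a b) (r s : ℝ) :
    g.IsConformalField (dualField a b r s) := by
  have hK := isSmooth_dualField h.left.smooth h.right.smooth h.wedge_ne_zero r s
  refine ⟨hK, fun x => (∑ k, dualField a b r s x k * partialDeriv k Ω x) / (2 * Ω x), ?_,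
    fun i j x => ?_⟩
  · exact (IsSmooth.sum fun k => (hK k).mul (h.smooth.partialDeriv k)).div
      ((IsSmooth.const 2).mul h.smooth) fun x => (mul_pos two_pos (h.pos x)).ne'
  · have h0 := (h.pos x).ne'
    rw [h.lieDeriv_dualField, h.comp_eq]
    field_simp

theorem inner_dualField (h : g.IsNullCoframe Ω a b) (r s : ℝ) (x : Torus) :
    g.inner x (dualField a b r s x) (dualField a b r s x) = 2 * Ω x * r * s := by
  rw [h.inner_eq, left_dotProduct_dualField (h.wedge_ne_zero x),
    right_dotProduct_dualField (h.wedge_ne_zero x)]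
  ring

end LorentzMetric.IsNullCoframe

/-! ### Conformal vector fields without null values -/

namespace LorentzMetric

variable {g : LorentzMetric} {K : Torus → Plane}

theorem inner_smooth (hK : ∀ k, IsSmooth fun x => K x k) :
    IsSmooth fun x => g.inner x (K x) (K x) :=
  IsSmooth.sum fun i => IsSmooth.sum fun j => ((g.smooth i j).mul (hK i)).mul (hK j)

theorem sum_mul_partialDeriv_inner (hK : ∀ k, IsSmooth fun x => K x k) (x : Torus) :
    ∑ k, K x k * partialDeriv k (fun y => g.inner y (K y) (K y)) x
      = ∑ i, ∑ j, g.lieDeriv K i j x * K x i * K x j := by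
  have hterm (i j : Fin 2) := ((g.smooth i j).mul (hK i)).mul (hK j)
  have hpderiv (k : Fin 2) : partialDeriv k (fun y => g.inner y (K y) (K y)) x
      = ∑ i, ∑ j, (partialDeriv k (fun y => g.comp y i j) x * K x i * K x j
        + g.comp x i j * partialDeriv k (fun y => K y i) x * K x j
        + g.comp x i j * K x i * partialDeriv k (fun y => K y j) x) := by
    simp only [inner, Fin.sum_univ_two]
    rw [partialDeriv_add ((hterm 0 0).add (hterm 0 1)) ((hterm 1 0).add (hterm 1 1)),
      partialDeriv_add (hterm 0 0) (hterm 0 1), partialDeriv_add (hterm 1 0) (hterm 1 1)]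
    simp only [partialDeriv_mul ((g.smooth _ _).mul (hK _)) (hK _),
      partialDeriv_mul (g.smooth _ _) (hK _)]
    ring
  simp only [hpderiv, lieDeriv, Fin.sum_univ_two]
  ring

theorem lieDeriv_rescale {Ω : Torus → ℝ} (hΩ : IsSmooth Ω) (h0 : ∀ x, Ω x ≠ 0) (i j : Fin 2)
    (x : Torus) : (g.rescale Ω hΩ h0).lieDeriv K i j x
      = (∑ k, K x k * partialDeriv k Ω x) * g.comp x i j + Ω x * g.lieDeriv K i j x := by
  simp only [lieDeriv, rescale, Matrix.smul_apply, smul_eq_mul,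
    partialDeriv_mul hΩ (g.smooth i j), Fin.sum_univ_two]
  ring

theorem IsConformalField.exists_unit_killing (hK : g.IsConformalField K)
    (h0 : ∀ x, g.inner x (K x) (K x) ≠ 0) :
    ∃ h : LorentzMetric, (∀ x, g.comp x = g.inner x (K x) (K x) • h.comp x) ∧
      (∀ x, h.inner x (K x) (K x) = 1) ∧ ∀ i j x, h.lieDeriv K i j x = 0 := by
  obtain ⟨hKs, σ, -, hσ⟩ := hK
  have hn := g.inner_smooth hKs
  have hm := hn.inv h0
  refine ⟨g.rescale _ hm fun x => inv_ne_zero (h0 x), fun x => (smul_inv_smul₀ (h0 x) _).symm,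
    fun x => ?_, fun i j x => ?_⟩
  · rw [← inv_mul_cancel₀ (h0 x)]
    simp only [inner, rescale, Matrix.smul_apply, smul_eq_mul, Finset.mul_sum, mul_assoc]
  · have hKn : ∑ k, K x k * partialDeriv k (fun y => g.inner y (K y) (K y)) x
        = 2 * σ x * g.inner x (K x) (K x) := by
      rw [sum_mul_partialDeriv_inner hKs]
      simp only [hσ, inner, Finset.mul_sum, mul_assoc]
    have hKm : ∑ k, K x k * partialDeriv k (fun y => (g.inner y (K y) (K y))⁻¹) x
        = -(2 * σ x * (g.inner x (K x) (K x))⁻¹) := by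
      have hprod (k : Fin 2) := partialDeriv_mul hm hn k x
      simp only [inv_mul_cancel₀ (h0 _), partialDeriv_const] at hprod
      apply mul_right_cancel₀ (h0 x)
      rw [Fin.sum_univ_two] at hKn ⊢
      linear_combination -(K x 0) * hprod 0 - K x 1 * hprod 1
        - (g.inner x (K x) (K x))⁻¹ * hKn
    rw [lieDeriv_rescale, hKm, hσ]
    ring

/-- The one-form `g(K, ·)`. -/
def lower (g : LorentzMetric) (K : Torus → Plane) (x : Torus) : Plane :=
  (g.comp x).mulVec (K x)

/-- The one-form `vol(K, ·)`, for the volume form of `g`. -/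
def contractVolume (g : LorentzMetric) (K : Torus → Plane) (x : Torus) : Plane :=
  √(-(g.comp x).det) • ![-K x 1, K x 0]

theorem lower_smooth (hK : ∀ k, IsSmooth fun x => K x k) (i : Fin 2) :
    IsSmooth fun x => g.lower K x i :=
  IsSmooth.sum fun j => (g.smooth i j).mul (hK j)

theorem inner_self_eq_sum_lower (x : Torus) :
    g.inner x (K x) (K x) = ∑ i, g.lower K x i * K x i := by
  simp only [inner, lower, Matrix.mulVec, dotProduct, Fin.sum_univ_two]
  ring

theorem partialDeriv_lower (hK : ∀ k, IsSmooth fun x => K x k) (i j : Fin 2) (x : Torus) :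
    partialDeriv i (fun y => g.lower K y j) x
      = ∑ k, (partialDeriv i (fun y => g.comp y j k) x * K x k
        + g.comp x j k * partialDeriv i (fun y => K y k) x) := by
  simp only [lower, Matrix.mulVec, dotProduct, Fin.sum_univ_two]
  rw [partialDeriv_add ((g.smooth _ _).mul (hK _)) ((g.smooth _ _).mul (hK _)),
    partialDeriv_mul (g.smooth _ _) (hK _), partialDeriv_mul (g.smooth _ _) (hK _)]

/-- Cartan's formula `ι_K dθ = L_K θ - d(θ(K))` for `θ = g(K, ·)`. -/
theorem sum_mul_partialDeriv_lower_sub (hK : ∀ k, IsSmooth fun x => K x k) (j : Fin 2) (x : Torus) :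
    ∑ i, K x i * (partialDeriv i (fun y => g.lower K y j) x
        - partialDeriv j (fun y => g.lower K y i) x)
      = ∑ i, g.lieDeriv K i j x * K x i
        - partialDeriv j (fun y => g.inner y (K y) (K y)) x := by
  have hθ i := g.lower_smooth hK i
  have hinner : partialDeriv j (fun y => g.inner y (K y) (K y)) x
      = ∑ i, (partialDeriv j (fun y => g.lower K y i) x * K x i
        + g.lower K x i * partialDeriv j (fun y => K y i) x) := by
    simp only [inner_self_eq_sum_lower, Fin.sum_univ_two]
    rw [partialDeriv_add ((hθ 0).mul (hK 0)) ((hθ 1).mul (hK 1)), partialDeriv_mul (hθ 0) (hK 0),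
      partialDeriv_mul (hθ 1) (hK 1)]
  simp only [hinner, partialDeriv_lower hK]
  simp only [lieDeriv, lower, Matrix.mulVec, dotProduct, Fin.sum_univ_two, g.comp_symm _ j 0,
    g.comp_symm _ j 1, g.comp_symm _ 1 0]
  ring

theorem isClosedForm_lower (hK : ∀ k, IsSmooth fun x => K x k)
    (hunit : ∀ x, g.inner x (K x) (K x) = 1) (hkill : ∀ i j x, g.lieDeriv K i j x = 0) :
    IsClosedForm (g.lower K) := by
  refine ⟨g.lower_smooth hK, fun x => ?_⟩
  have hcartan j := sum_mul_partialDeriv_lower_sub (g := g) hK j x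
  simp only [hkill, hunit, partialDeriv_const, Fin.sum_univ_two, zero_mul] at hcartan
  have hn := hunit x
  rw [inner_self_eq_sum_lower, Fin.sum_univ_two] at hn
  linear_combination g.lower K x 0 * hcartan 1 - g.lower K x 1 * hcartan 0
    - (partialDeriv 0 (fun y => g.lower K y 1) x - partialDeriv 1 (fun y => g.lower K y 0) x) * hn

theorem sum_mul_partialDeriv_det (x : Torus) :
    ∑ k, (K x k * partialDeriv k (fun y => (g.comp y).det) x
        + 2 * (g.comp x).det * partialDeriv k (fun y => K y k) x)
      = g.comp x 1 1 * g.lieDeriv K 0 0 x + g.comp x 0 0 * g.lieDeriv K 1 1 x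
        - 2 * g.comp x 0 1 * g.lieDeriv K 0 1 x := by
  have hs := g.smooth
  have hdet (k : Fin 2) : partialDeriv k (fun y => (g.comp y).det) x
      = partialDeriv k (fun y => g.comp y 0 0) x * g.comp x 1 1
        + g.comp x 0 0 * partialDeriv k (fun y => g.comp y 1 1) x
        - 2 * g.comp x 0 1 * partialDeriv k (fun y => g.comp y 0 1) x := by
    simp only [det_comp]
    rw [partialDeriv_sub ((hs 0 0).mul (hs 1 1)) ((hs 0 1).mul (hs 0 1)),
      partialDeriv_mul (hs 0 0) (hs 1 1), partialDeriv_mul (hs 0 1) (hs 0 1)]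
    ring
  simp only [hdet]
  simp only [det_comp, lieDeriv, Fin.sum_univ_two, g.comp_symm _ 1 0]
  ring

/-- `d(vol(K, ·))` is the divergence of `K`, which vanishes for a Killing field. -/
theorem isClosedForm_contractVolume (hK : ∀ k, IsSmooth fun x => K x k)
    (hkill : ∀ i j x, g.lieDeriv K i j x = 0) : IsClosedForm (g.contractVolume K) := by
  have hs : IsSmooth fun x => √(-(g.comp x).det) :=
    g.det_comp_smooth.neg.sqrt fun x => (neg_pos.2 (g.lorentzian x)).ne'
  refine ⟨Fin.forall_fin_two.2 ⟨hs.mul (hK 1).neg, hs.mul (hK 0)⟩, fun x => ?_⟩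
  have hpos : √(-(g.comp x).det) ≠ 0 := (Real.sqrt_pos.2 (neg_pos.2 (g.lorentzian x))).ne'
  have hsq (y : Torus) : √(-(g.comp y).det) * √(-(g.comp y).det) = -(g.comp y).det :=
    Real.mul_self_sqrt (neg_pos.2 (g.lorentzian y)).le
  have hpsq (k : Fin 2) := partialDeriv_mul hs hs k x
  simp only [hsq, partialDeriv_neg g.det_comp_smooth] at hpsq
  have hdet := sum_mul_partialDeriv_det (g := g) (K := K) x
  simp only [hkill, mul_zero, add_zero, sub_zero, Fin.sum_univ_two] at hdet
  simp only [contractVolume, Pi.smul_apply, smul_eq_mul, Matrix.cons_val_zero,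
    Matrix.cons_val_one]
  rw [partialDeriv_mul hs (hK 0), partialDeriv_mul hs (hK 1).neg, partialDeriv_neg (hK 1)]
  apply mul_left_cancel₀ (mul_ne_zero two_ne_zero hpos)
  linear_combination -(K x 0) * hpsq 0 - K x 1 * hpsq 1 - hdet + 2 *
    (partialDeriv 0 (fun y => K y 0) x + partialDeriv 1 (fun y => K y 1) x) * hsq x

theorem comp_eq_lower_mul_sub_contractVolume_mul {x : Torus} (hunit : g.inner x (K x) (K x) = 1)
    (i j : Fin 2) : g.comp x i j
      = g.lower K x i * g.lower K x j - g.contractVolume K x i * g.contractVolume K x j := by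
  have hsq : √(-(g.comp x).det) * √(-(g.comp x).det) = -(g.comp x).det :=
    Real.mul_self_sqrt (neg_pos.2 (g.lorentzian x)).le
  simp only [inner, Fin.sum_univ_two, g.comp_symm _ 1 0] at hunit
  rw [det_comp] at hsq
  fin_cases i <;> fin_cases j <;>
    simp only [Fin.zero_eta, Fin.mk_one, lower, contractVolume, det_comp, Matrix.mulVec, dotProduct,
      Fin.sum_univ_two, Pi.smul_apply, smul_eq_mul, Matrix.cons_val_zero, Matrix.cons_val_one,
      g.comp_symm _ 1 0]
  · linear_combination K x 1 ^ 2 * hsq - g.comp x 0 0 * hunit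
  · linear_combination -(K x 0 * K x 1) * hsq - g.comp x 0 1 * hunit
  · linear_combination -(K x 0 * K x 1) * hsq - g.comp x 0 1 * hunit
  · linear_combination K x 0 ^ 2 * hsq - g.comp x 1 1 * hunit

theorem IsConformalField.exists_isNullCoframe (hK : g.IsConformalField K) {ε : ℝ}
    (hε : ε * ε = 1) (hpos : ∀ x, 0 < ε * g.inner x (K x) (K x)) :
    ∃ Ω a b, g.IsNullCoframe Ω a b := by
  obtain ⟨h, hg, hunit, hkill⟩ :=
    hK.exists_unit_killing fun x h0 => (hpos x).ne' (by rw [h0, mul_zero])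
  have hθ := isClosedForm_lower hK.1 hunit hkill
  have hψ := isClosedForm_contractVolume hK.1 hkill
  refine ⟨fun x => ε * g.inner x (K x) (K x),
    fun x => (ε / 2) • (h.lower K x + h.contractVolume K x),
    fun x => h.lower K x + (-1 : ℝ) • h.contractVolume K x,
    (IsSmooth.const ε).mul (g.inner_smooth hK.1), hpos,
    (hθ.add hψ).const_smul _, hθ.add (hψ.const_smul _), fun x i j => ?_⟩
  rw [hg, Matrix.smul_apply, smul_eq_mul, comp_eq_lower_mul_sub_contractVolume_mul (hunit x)]
  simp only [Pi.smul_apply, Pi.add_apply, smul_eq_mul]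
  linear_combination -(g.inner x (K x) (K x) * (h.lower K x i * h.lower K x j
    - h.contractVolume K x i * h.contractVolume K x j)) * hε

end LorentzMetric

/-! ### Closed null coframes of flat metrics -/

section Primitives

variable {E F : Type*} [NormedAddCommGroup E] [NormedSpace ℝ E]
  [NormedAddCommGroup F] [NormedSpace ℝ F]

theorem exists_contDiff_primitive [CompleteSpace F] {η : E → E →L[ℝ] F} (hη : ContDiff ℝ ∞ η)
    (hsymm : ∀ p u w, fderiv ℝ η p u w = fderiv ℝ η p w u) :
    ∃ f : E → F, ContDiff ℝ ∞ f ∧ ∀ p, HasFDerivAt f (η p) p := by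
  obtain ⟨f, hf⟩ := convex_univ.exists_forall_hasFDerivAt_of_fderiv_symmetric isOpen_univ
    (hη.differentiable (by simp)).differentiableOn fun p _ => hsymm p
  simp only [Set.mem_univ, true_implies] at hf
  refine ⟨f, contDiff_infty_iff_fderiv.2 ⟨fun p => (hf p).differentiableAt, ?_⟩, hf⟩
  rwa [show fderiv ℝ f = η from funext fun p => (hf p).fderiv]

theorem exists_contDiff_exp_eq {n : ℕ∞} {z : E → ℂ} (hz : ContDiff ℝ n z) (h0 : ∀ p, z p ≠ 0) :
    ∃ l : E → ℂ, ContDiff ℝ n l ∧ ∀ p, Complex.exp (l p) = z p := by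
  have hE : IsSimplyConnected (Set.univ : Set E) := by
    have := (convex_univ (𝕜 := ℝ) (E := E)).contractibleSpace Set.univ_nonempty
    exact SimplyConnectedSpace.ofContractible _
  obtain ⟨l, hl, hlz⟩ := Complex.exists_continuousOn_eqOn_exp_comp hE isOpen_univ
    hz.continuous.continuousOn (by simpa using h0)
  replace hlz p : Complex.exp (l p) = z p := hlz (Set.mem_univ p)
  rw [continuousOn_univ] at hl
  refine ⟨l, contDiff_iff_contDiffAt.2 fun p => ?_, hlz⟩
  have hone : z p / z p ∈ Complex.slitPlane := by simp [h0 p]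
  have hlog : ContDiffAt ℝ n (fun q => Complex.log (z q / z p)) p :=
    ((Complex.contDiffAt_log hone).restrict_scalars ℝ).comp (f := fun q => z q / z p) p
      (hz.contDiffAt.div_const (z p))
  refine (contDiffAt_const.add hlog).congr_of_eventuallyEq
    (f := fun q => l p + Complex.log (z q / z p)) ?_
  have him : Filter.Tendsto (fun q => (l q - l p).im) (𝓝 p) (𝓝 0) := by
    have hcont : Continuous fun q => (l q - l p).im := by fun_prop
    exact hcont.tendsto' p 0 (by simp)
  filter_upwards [him.eventually (Ioo_mem_nhds (neg_lt_zero.2 Real.pi_pos) Real.pi_pos)] with q hq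
  rw [← hlz q, ← hlz p, ← Complex.exp_sub, Complex.log_exp hq.1 hq.2.le]
  ring

theorem exists_contDiff_sq_eq {n : ℕ∞} {z : E → ℂ} (hz : ContDiff ℝ n z) (h0 : ∀ p, z p ≠ 0) :
    ∃ q : E → ℂ, ContDiff ℝ n q ∧ ∀ p, q p ^ 2 = z p := by
  obtain ⟨l, hl, hlz⟩ := exists_contDiff_exp_eq hz h0
  refine ⟨fun p => Complex.exp (l p / 2), (hl.div_const 2).cexp, fun p => ?_⟩
  rw [← Complex.exp_nat_mul, ← hlz p]
  congr 1
  push_cast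
  ring

theorem exists_contDiff_sq_sub_sq_eq {n : ℕ∞} {x y : E → ℝ} (hx : ContDiff ℝ n x)
    (hy : ContDiff ℝ n y) (h0 : ∀ p, 0 < x p ^ 2 + y p ^ 2) :
    ∃ c d : E → ℝ, ContDiff ℝ n c ∧ ContDiff ℝ n d ∧ (∀ p, c p ^ 2 - d p ^ 2 = x p) ∧
      ∀ p, 2 * c p * d p = y p := by
  obtain ⟨q, hq, hqz⟩ := exists_contDiff_sq_eq (z := fun p => (x p : ℂ) + (y p : ℂ) * Complex.I)
    ((Complex.ofRealCLM.contDiff.comp hx).add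
      ((Complex.ofRealCLM.contDiff.comp hy).mul contDiff_const)) fun p h => by
    rw [← Complex.mk_eq_add_mul_I, Complex.ext_iff] at h
    obtain ⟨hx0, hy0⟩ : x p = 0 ∧ y p = 0 := h
    simpa [hx0, hy0] using h0 p
  refine ⟨fun p => (q p).re, fun p => (q p).im, Complex.reCLM.contDiff.comp hq,
    Complex.imCLM.contDiff.comp hq, fun p => ?_, fun p => ?_⟩
  · rw [sq, sq, ← Complex.mul_re, ← sq, hqz]
    simp
  · rw [show 2 * (q p).re * (q p).im = (q p * q p).im by rw [Complex.mul_im]; ring, ← sq, hqz]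
    simp

end Primitives

theorem exists_primitive {a : Plane → Plane} (ha : ContDiff ℝ ∞ a)
    (hclosed : ∀ i j p, pderiv i (fun q => a q j) p = pderiv j (fun q => a q i) p) :
    ∃ f : Plane → ℝ, ContDiff ℝ ∞ f ∧ ∀ i p, pderiv i f p = a p i := by
  let η : Plane → Plane →L[ℝ] ℝ := fun p =>
    ∑ i, a p i • (ContinuousLinearMap.proj i : Plane →L[ℝ] ℝ)
  have hη : ContDiff ℝ ∞ η := ContDiff.sum fun i _ => (contDiff_pi.1 ha i).smul contDiff_const
  have hdη p u w : fderiv ℝ η p u w = ∑ i, ∑ j, pderiv j (fun q => a q i) p * u j * w i := by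
    have ha' i := (contDiff_pi.1 ha i).differentiable (by simp) p
    have : HasFDerivAt η (∑ i, (fderiv ℝ (fun q => a q i) p).smulRight
        (ContinuousLinearMap.proj i : Plane →L[ℝ] ℝ)) p :=
      HasFDerivAt.fun_sum fun i _ => (ha' i).hasFDerivAt.smul_const
        (ContinuousLinearMap.proj i : Plane →L[ℝ] ℝ)
    simp [this.fderiv, fderiv_eq_sum_pderiv, add_mul]
  obtain ⟨f, hf, hfη⟩ := exists_contDiff_primitive hη fun p u w => by
    rw [hdη, hdη, Finset.sum_comm]
    refine Finset.sum_congr rfl fun i _ => Finset.sum_congr rfl fun j _ => ?_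
    rw [hclosed]
    ring
  refine ⟨f, hf, fun i p => ?_⟩
  rw [pderiv, (hfη p).fderiv]
  fin_cases i <;> simp [η]

namespace LorentzMetric

variable {g : LorentzMetric} {a b : Plane → Plane}

/-- The two forms are multiples of `A (c, d) ∓ B (-d, c)`, where `A` and `B` are the square roots of
`c² + d² ± m`. -/
theorem exists_isLiftedNullCoframe_of_polar {m c d : Plane → ℝ} (hm : ContDiff ℝ ∞ m)
    (hc : ContDiff ℝ ∞ c) (hd : ContDiff ℝ ∞ d) (hlt : ∀ p, |m p| < c p ^ 2 + d p ^ 2)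
    (h00 : ∀ p, g.comp (proj p) 0 0 = m p + (c p ^ 2 - d p ^ 2))
    (h11 : ∀ p, g.comp (proj p) 1 1 = m p - (c p ^ 2 - d p ^ 2))
    (h01 : ∀ p, g.comp (proj p) 0 1 = 2 * c p * d p) : ∃ a b, g.IsLiftedNullCoframe a b := by
  let ρ : Plane → ℝ := fun p => c p ^ 2 + d p ^ 2
  have hρ : ContDiff ℝ ∞ ρ := (hc.pow 2).add (hd.pow 2)
  have hadd p : 0 < ρ p + m p := by linarith [(abs_lt.1 (hlt p)).1]
  have hsub p : 0 < ρ p - m p := by linarith [(abs_lt.1 (hlt p)).2]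
  have hρ0 p : 2 * ρ p ≠ 0 := by linarith [hadd p, hsub p]
  let A : Plane → ℝ := fun p => √(ρ p + m p)
  let B : Plane → ℝ := fun p => √(ρ p - m p)
  have hA : ContDiff ℝ ∞ A := (hρ.add hm).sqrt fun p => (hadd p).ne'
  have hB : ContDiff ℝ ∞ B := (hρ.sub hm).sqrt fun p => (hsub p).ne'
  refine ⟨fun p => (2 * ρ p)⁻¹ • ![A p * c p + B p * d p, A p * d p - B p * c p],
    fun p => ![A p * c p - B p * d p, A p * d p + B p * c p], ?_, ?_, fun p i j => ?_⟩
  · refine ((contDiff_const.mul hρ).inv hρ0).smul (contDiff_pi.2 (Fin.forall_fin_two.2 ⟨?_, ?_⟩))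
    exacts [(hA.mul hc).add (hB.mul hd), (hA.mul hd).sub (hB.mul hc)]
  · refine contDiff_pi.2 (Fin.forall_fin_two.2 ⟨?_, ?_⟩)
    exacts [(hA.mul hc).sub (hB.mul hd), (hA.mul hd).add (hB.mul hc)]
  · have hAA : A p ^ 2 = c p ^ 2 + d p ^ 2 + m p := Real.sq_sqrt (hadd p).le
    have hBB : B p ^ 2 = c p ^ 2 + d p ^ 2 - m p := Real.sq_sqrt (hsub p).le
    have hr : (2 * ρ p)⁻¹ * (2 * (c p ^ 2 + d p ^ 2)) = 1 := inv_mul_cancel₀ (hρ0 p)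
    fin_cases i <;> fin_cases j <;>
      simp only [Fin.zero_eta, Fin.mk_one, Pi.smul_apply, smul_eq_mul, Matrix.cons_val_zero,
        Matrix.cons_val_one, g.comp_symm (proj p) 1 0, h00, h11, h01]
    · linear_combination 2 * (2 * ρ p)⁻¹ * (d p ^ 2 * hBB - c p ^ 2 * hAA)
        - (m p + (c p ^ 2 - d p ^ 2)) * hr
    · linear_combination -2 * (2 * ρ p)⁻¹ * c p * d p * (hAA + hBB) - 2 * c p * d p * hr
    · linear_combination -2 * (2 * ρ p)⁻¹ * c p * d p * (hAA + hBB) - 2 * c p * d p * hr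
    · linear_combination 2 * (2 * ρ p)⁻¹ * (c p ^ 2 * hBB - d p ^ 2 * hAA)
        - (m p - (c p ^ 2 - d p ^ 2)) * hr

/-- The complex function `(g₀₀ - g₁₁) / 2 + i g₀₁` vanishes nowhere since `g` is Lorentzian, so it
has a smooth square root on the simply connected plane. -/
theorem exists_isLiftedNullCoframe (g : LorentzMetric) : ∃ a b, g.IsLiftedNullCoframe a b := by
  let m : Plane → ℝ := fun p => (g.comp (proj p) 0 0 + g.comp (proj p) 1 1) / 2
  let x : Plane → ℝ := fun p => (g.comp (proj p) 0 0 - g.comp (proj p) 1 1) / 2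
  let y : Plane → ℝ := fun p => g.comp (proj p) 0 1
  have hm : ContDiff ℝ ∞ m := (ContDiff.add (g.smooth 0 0) (g.smooth 1 1)).div_const 2
  have hx : ContDiff ℝ ∞ x := (ContDiff.sub (g.smooth 0 0) (g.smooth 1 1)).div_const 2
  have hxy p : m p ^ 2 < x p ^ 2 + y p ^ 2 := by
    have := g.lorentzian (proj p)
    rw [g.det_comp] at this
    simp only [m, x, y]
    linarith
  obtain ⟨c, d, hc, hd, hcd, hcd'⟩ := exists_contDiff_sq_sub_sq_eq hx (g.smooth 0 1) fun p =>
    (sq_nonneg (m p)).trans_lt (hxy p)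
  refine exists_isLiftedNullCoframe_of_polar hm hc hd (fun p => ?_) (fun p => ?_) (fun p => ?_)
    fun p => (hcd' p).symm
  · apply abs_lt_of_sq_lt_sq _ (by positivity)
    calc m p ^ 2 < x p ^ 2 + y p ^ 2 := hxy p
      _ = (c p ^ 2 + d p ^ 2) ^ 2 := by rw [← hcd, show y p = _ from (hcd' p).symm]; ring
  · rw [hcd]
    ring
  · rw [hcd]
    ring

theorem covDeriv_smul {φ : Plane → ℝ} {p : Plane} (hφ : DifferentiableAt ℝ φ p)
    (ha : DifferentiableAt ℝ a p) (l i : Fin 2) :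
    g.covDeriv (fun q => φ q • a q) l i p = pderiv l φ p * a p i + φ p * g.covDeriv a l i p := by
  simp only [covDeriv, Pi.smul_apply, smul_eq_mul, Fin.sum_univ_two]
  rw [pderiv_mul hφ (differentiableAt_pi.1 ha i)]
  ring

/-- By flatness the connection form `ν` is closed, hence `ν = dh`, and rescaling by `e^{∓h}` makes
both members of the coframe parallel. -/
theorem IsFlat.exists_parallel_isLiftedNullCoframe (hflat : g.IsFlat) :
    ∃ a b, g.IsLiftedNullCoframe a b ∧
      (∀ l i p, g.covDeriv a l i p = 0) ∧ ∀ l i p, g.covDeriv b l i p = 0 := by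
  obtain ⟨a, b, hab⟩ := g.exists_isLiftedNullCoframe
  obtain ⟨ν, hν, hνa, hνb⟩ := hab.exists_connection_form
  have hclosed i j p : pderiv i (fun q => ν q j) p = pderiv j (fun q => ν q i) p := by
    have hrec k := g.sum_curvature_mul_of_recurrent hab.contDiff_left hν hνa k j i p
    simp only [hflat _ _ _ _ _, zero_mul, Finset.sum_const_zero] at hrec
    by_contra hne
    have ha0 : a p = 0 :=
      funext fun k => (mul_eq_zero.1 (hrec k).symm).resolve_left (sub_ne_zero.2 hne)
    exact hab.wedge_ne_zero p (by simp [wedge, ha0])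
  obtain ⟨h, hh, hhν⟩ := exists_primitive hν hclosed
  have hdh p : DifferentiableAt ℝ h p := hh.differentiable (by simp) p
  have hdneg i p : pderiv i (fun q => Real.exp (-h q)) p = -Real.exp (-h p) * ν p i := by
    rw [pderiv_comp (φ := fun s => Real.exp (-s)) (hasDerivAt_neg _).exp (hdh p), hhν]
    ring
  have hdpos i p : pderiv i (fun q => Real.exp (h q)) p = Real.exp (h p) * ν p i := by
    rw [pderiv_comp (Real.hasDerivAt_exp _) (hdh p), hhν]
  refine ⟨fun p => Real.exp (-h p) • a p, fun p => Real.exp (h p) • b p,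
    ⟨hh.neg.exp.smul hab.contDiff_left, hh.exp.smul hab.contDiff_right, fun p i j => ?_⟩,
    fun l i p => ?_, fun l i p => ?_⟩
  · have hexp : Real.exp (-h p) * Real.exp (h p) = 1 := by rw [← Real.exp_add]; simp
    rw [hab.comp_eq]
    simp only [Pi.smul_apply, smul_eq_mul]
    linear_combination -(a p i * b p j + a p j * b p i) * hexp
  · rw [covDeriv_smul (hh.neg.exp.differentiable (by simp) p)
      (hab.contDiff_left.differentiable (by simp) p), hdneg, hνa]
    ring
  · rw [covDeriv_smul (hh.exp.differentiable (by simp) p)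
      (hab.contDiff_right.differentiable (by simp) p), hdpos, hνb]
    ring

end LorentzMetric

/-- The wedge product is determined up to sign by the symmetric product, so under the hypothesis on
the signs even the tensor products agree: `a' ⊗ b' = a ⊗ b`. -/
theorem exists_eq_smul_of_symm_product_eq {a b a' b' : Plane}
    (h : ∀ i j, a' i * b' j + a' j * b' i = a i * b j + a j * b i)
    (hw : 0 < wedge a' b' * wedge a b) :
    wedge a' b / wedge a b ≠ 0 ∧ a' = (wedge a' b / wedge a b) • a ∧
      b' = (wedge a' b / wedge a b)⁻¹ • b := by
  have hne : wedge a b ≠ 0 := right_ne_zero_of_mul hw.ne'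
  have hne' : wedge a' b' ≠ 0 := left_ne_zero_of_mul hw.ne'
  have hwedge : wedge a' b' = wedge a b := by
    have hsq : wedge a' b' ^ 2 = wedge a b ^ 2 := by
      have h00 := h 0 0
      have h01 := h 0 1
      have h11 := h 1 1
      unfold wedge
      linear_combination (a' 0 * b' 1 + a' 1 * b' 0 + a 0 * b 1 + a 1 * b 0) * h01
        - 2 * a' 1 * b' 1 * h00 - 2 * a 0 * b 0 * h11
    refine (sq_eq_sq_iff_eq_or_eq_neg.1 hsq).resolve_right fun hneg => ?_
    nlinarith [sq_nonneg (wedge a b)]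
  have htensor : ∀ i j, a' i * b' j = a i * b j := by
    have h01 := h 0 1
    unfold wedge at hwedge
    refine Fin.forall_fin_two.2 ⟨Fin.forall_fin_two.2 ⟨?_, ?_⟩, Fin.forall_fin_two.2 ⟨?_, ?_⟩⟩
    exacts [by linarith [h 0 0], by linarith, by linarith, by linarith [h 1 1]]
  obtain ⟨i, hi⟩ : ∃ i, a i ≠ 0 :=
    Function.ne_iff.1 fun h0 => hne (by simp [wedge, h0])
  obtain ⟨j, hj⟩ : ∃ j, b' j ≠ 0 :=
    Function.ne_iff.1 fun h0 => hne' (by simp [wedge, h0])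
  have ha' : a' = (wedge a' b / wedge a b) • a := by
    funext k
    rw [Pi.smul_apply, smul_eq_mul, div_mul_eq_mul_div, eq_div_iff hne]
    apply mul_right_cancel₀ hj
    unfold wedge
    linear_combination (a 0 * b 1 - a 1 * b 0) * htensor k j - b 1 * a k * htensor 0 j
      + b 0 * a k * htensor 1 j
  have hl : wedge a' b / wedge a b ≠ 0 := fun h0 => hne' (by rw [ha', h0]; simp [wedge])
  refine ⟨hl, ha', (eq_inv_smul_iff₀ hl).2 (funext fun k => mul_left_cancel₀ hi ?_)⟩
  rw [← htensor, Pi.smul_apply, smul_eq_mul, ← mul_assoc, mul_comm (a i)]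
  exact congrArg (· * b' k) (congrFun ha' i).symm

theorem mul_pos_of_continuous_of_ne_zero {X : Type*} [TopologicalSpace X] [PreconnectedSpace X]
    {f : X → ℝ} (hf : Continuous f) (h0 : ∀ x, f x ≠ 0) (x y : X) : 0 < f x * f y := by
  by_contra hneg
  have hzero : (0 : ℝ) ∈ Set.range f := by
    rcases mul_nonpos_iff.1 (not_lt.1 hneg) with ⟨hx, hy⟩ | ⟨hx, hy⟩
    · exact mem_range_of_exists_le_of_exists_ge hf ⟨y, hy⟩ ⟨x, hx⟩
    · exact mem_range_of_exists_le_of_exists_ge hf ⟨x, hx⟩ ⟨y, hy⟩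
  exact hzero.elim h0

theorem contDiff_wedge {a b : Plane → Plane} (ha : ContDiff ℝ ∞ a) (hb : ContDiff ℝ ∞ b) :
    ContDiff ℝ ∞ fun p => wedge (a p) (b p) :=
  ((contDiff_pi.1 ha 0).mul (contDiff_pi.1 hb 1)).sub
    ((contDiff_pi.1 ha 1).mul (contDiff_pi.1 hb 0))

theorem LorentzMetric.IsLiftedNullCoframe.exists_multiplier {g : LorentzMetric}
    {a b : Plane → Plane} (hab : g.IsLiftedNullCoframe a b)
    (hpar : ∀ l i p, g.covDeriv a l i p = 0) {n : Plane} (hn : proj n = 0) :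
    ∃ c : ℝ, c ≠ 0 ∧ ∀ p, a (p + n) = c • a p ∧ b (p + n) = c⁻¹ • b p := by
  have htrans : ContDiff ℝ ∞ fun p : Plane => p + n := contDiff_id.add contDiff_const
  have hw : ContDiff ℝ ∞ fun p => wedge (a p) (b p) :=
    contDiff_wedge hab.contDiff_left hab.contDiff_right
  have hsmul p := exists_eq_smul_of_symm_product_eq (a := a p) (b := b p) (a' := a (p + n))
    (b' := b (p + n)) (fun i j => by rw [← hab.comp_eq, ← hab.comp_eq, proj_add_eq_self hn])
    (mul_pos_of_continuous_of_ne_zero hw.continuous hab.wedge_ne_zero _ _)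
  set c : Plane → ℝ := fun p => wedge (a (p + n)) (b p) / wedge (a p) (b p)
  have hc : ContDiff ℝ ∞ c :=
    (contDiff_wedge (hab.contDiff_left.comp htrans) hab.contDiff_right).div hw hab.wedge_ne_zero
  have hdc l p : pderiv l c p = 0 := by
    by_contra hne
    have hshift i : g.covDeriv (fun q => a (q + n)) l i p = g.covDeriv a l i (p + n) := by
      simp only [covDeriv, pderiv_comp_add_right (fun q => a q i), proj_add_eq_self hn]
    have ha0 : a p = 0 := funext fun i => by
      have := hshift i
      rw [show (fun q => a (q + n)) = fun q => c q • a q from funext fun q => (hsmul q).2.1,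
        covDeriv_smul (hc.differentiable (by simp) p)
          (hab.contDiff_left.differentiable (by simp) p), hpar, hpar, mul_zero, add_zero] at this
      exact (mul_eq_zero.1 this).resolve_left hne
    exact hab.wedge_ne_zero p (by simp [wedge, ha0])
  have hconst p : c p = c 0 := eq_of_pderiv_eq_zero (hc.differentiable (by simp)) hdc p 0
  refine ⟨c 0, (hsmul 0).1, fun p => ?_⟩
  rw [← hconst p]
  exact (hsmul p).2

/-- The affine maps describing how `F` changes under deck transformations commute, so the fixed
point of one of them which is not a translation is common to all of them. -/
theorem exists_forall_sub_eq_mul_sub {F : Plane → ℝ} (hF : Differentiable ℝ F) {c : Plane → ℝ}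
    (hc : ∀ m, proj m = 0 → ∀ p i, pderiv i F (p + m) = c m * pderiv i F p) {n : Plane}
    (hn : proj n = 0) (hcn : c n ≠ 1) :
    ∃ d, ∀ m, proj m = 0 → ∀ p, F (p + m) - d = c m * (F p - d) := by
  have haffine : ∀ m, proj m = 0 → ∃ k, ∀ p, F (p + m) = c m * F p + k := fun m hm =>
    exists_eq_add_const (hF.comp (differentiable_id.add_const m)) (hF.const_mul (c m)) fun i p => by
      rw [pderiv_comp_add_right, hc m hm, pderiv_const_mul (hF p)]
  obtain ⟨k, hk⟩ := haffine n hn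
  have hcn' : 1 - c n ≠ 0 := sub_ne_zero.2 hcn.symm
  refine ⟨k / (1 - c n), fun m hm p => ?_⟩
  obtain ⟨k', hk'⟩ := haffine m hm
  have hcomm : c n * (c m * F p + k') + k = c m * (c n * F p + k) + k' := by
    rw [← hk', ← hk, ← hk, ← hk', add_right_comm]
  rw [hk']
  field_simp
  linear_combination -hcomm

theorem eq_zero_of_forall_critical_eq_zero {F : Plane → ℝ} (hF : ContDiff ℝ ∞ F)
    (hper : ∀ p n, proj n = 0 → F (p + n) = F p)
    (hcrit : ∀ p, (∀ i, pderiv i F p = 0) → F p = 0) (p : Plane) : F p = 0 := by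
  obtain ⟨f, hf⟩ := exists_descent hper
  have hfc : Continuous f := IsSmooth.continuous (by simpa only [IsSmooth, hf] using hF)
  have hext q (hq : IsLocalExtr F q) : F q = 0 :=
    hcrit q fun i => by simp [pderiv, hq.fderiv_eq_zero]
  obtain ⟨x, -, hx⟩ := isCompact_univ.exists_isMaxOn Set.univ_nonempty hfc.continuousOn
  obtain ⟨y, -, hy⟩ := isCompact_univ.exists_isMinOn Set.univ_nonempty hfc.continuousOn
  obtain ⟨q, rfl⟩ := proj_surjective x
  obtain ⟨r, rfl⟩ := proj_surjective y
  have hmax s : F s ≤ F q := by simpa only [← hf] using isMaxOn_univ_iff.1 hx (proj s)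
  have hmin s : F r ≤ F s := by simpa only [← hf] using isMinOn_univ_iff.1 hy (proj s)
  exact le_antisymm ((hmax p).trans_eq (hext q (Or.inr (.of_forall hmax))))
    ((hext r (Or.inl (.of_forall hmin))).symm.trans_le (hmin p))

/-- Normalized to vanish at a common fixed point, the two functions have an invariant product, all
of whose critical points are zeros. -/
theorem multiplier_eq_one {ξ η : Plane → ℝ} (hξ : ContDiff ℝ ∞ ξ) (hη : ContDiff ℝ ∞ η)
    (hw : ∀ p, wedge (fun i => pderiv i ξ p) (fun i => pderiv i η p) ≠ 0) {c : Plane → ℝ}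
    (hc : ∀ n, proj n = 0 → c n ≠ 0)
    (hcξ : ∀ n, proj n = 0 → ∀ p i, pderiv i ξ (p + n) = c n * pderiv i ξ p)
    (hcη : ∀ n, proj n = 0 → ∀ p i, pderiv i η (p + n) = (c n)⁻¹ * pderiv i η p)
    {n : Plane} (hn : proj n = 0) : c n = 1 := by
  by_contra hcn
  have hdξ := hξ.differentiable (by simp)
  have hdη := hη.differentiable (by simp)
  obtain ⟨d, hd⟩ := exists_forall_sub_eq_mul_sub hdξ hcξ hn hcn
  obtain ⟨d', hd'⟩ := exists_forall_sub_eq_mul_sub (c := fun m => (c m)⁻¹) hdη hcη hn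
    (inv_ne_one.2 hcn)
  let F : Plane → ℝ := fun p => (ξ p - d) * (η p - d')
  have hcrit p (hp : ∀ i, pderiv i F p = 0) : ξ p = d ∧ η p = d' := by
    have hdF i : pderiv i ξ p * (η p - d') + (ξ p - d) * pderiv i η p = 0 := by
      rw [← hp i, pderiv_mul ((hdξ p).sub_const d) ((hdη p).sub_const d'),
        pderiv_sub (hdξ p) (differentiableAt_const d), pderiv_const,
        pderiv_sub (hdη p) (differentiableAt_const d'), pderiv_const, sub_zero, sub_zero]
    constructor <;> refine sub_eq_zero.1 (mul_right_cancel₀ (hw p) ?_) <;> unfold wedge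
    · linear_combination pderiv 0 ξ p * hdF 1 - pderiv 1 ξ p * hdF 0
    · linear_combination pderiv 1 η p * hdF 0 - pderiv 0 η p * hdF 1
  have hF0 : F = fun _ => 0 := funext <| eq_zero_of_forall_critical_eq_zero
    ((hξ.sub contDiff_const).mul (hη.sub contDiff_const))
    (fun p m hm => by
      simp only [F, hd m hm, hd' m hm]
      rw [mul_mul_mul_comm, mul_inv_cancel₀ (hc m hm), one_mul])
    fun p hp => by simp [F, hcrit p hp]
  have hξ0 : ξ = fun _ => d := funext fun p => (hcrit p fun i => by rw [hF0, pderiv_const]).1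
  exact hw 0 (by simp [wedge, hξ0, pderiv_const])

/-- The members of a parallel null coframe of the plane are closed, and invariant under the deck
transformations. -/
theorem LorentzMetric.IsFlat.exists_isNullCoframe {g : LorentzMetric} (hflat : g.IsFlat) :
    ∃ a b, g.IsNullCoframe (fun _ => 1) a b := by
  obtain ⟨a, b, hab, hpa, hpb⟩ := hflat.exists_parallel_isLiftedNullCoframe
  have hclosed {a : Plane → Plane} (hpar : ∀ l i p, g.covDeriv a l i p = 0) (i j p) :
      pderiv i (fun q => a q j) p = pderiv j (fun q => a q i) p := by
    rw [← sub_eq_zero, ← g.covDeriv_sub_covDeriv_swap a i j p, hpar, hpar, sub_zero]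
  obtain ⟨ξ, hξ, hξa⟩ := exists_primitive hab.contDiff_left (hclosed hpa)
  obtain ⟨η, hη, hηb⟩ := exists_primitive hab.contDiff_right (hclosed hpb)
  choose! c hc0 hc using fun n (hn : proj n = 0) => hab.exists_multiplier hpa hn
  have hc1 n (hn : proj n = 0) : c n = 1 := multiplier_eq_one hξ hη
    (fun p => by simpa only [hξa, hηb] using hab.wedge_ne_zero p) hc0
    (fun n hn p i => by simp only [hξa, (hc n hn p).1, Pi.smul_apply, smul_eq_mul])
    (fun n hn p i => by simp only [hηb, (hc n hn p).2, Pi.smul_apply, smul_eq_mul]) hn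
  obtain ⟨a', ha'⟩ := exists_descent (F := a) fun p n hn => by
    rw [(hc n hn p).1, hc1 n hn, one_smul]
  obtain ⟨b', hb'⟩ := exists_descent (F := b) fun p n hn => by
    rw [(hc n hn p).2, hc1 n hn, inv_one, one_smul]
  have hdescent {a : Plane → Plane} {a' : Torus → Plane} (ha : ContDiff ℝ ∞ a)
      (hpar : ∀ l i p, g.covDeriv a l i p = 0) (ha' : ∀ p, a' (proj p) = a p) :
      IsClosedForm a' := by
    have hs i : IsSmooth fun x => a' x i := by
      simpa only [IsSmooth, ha'] using contDiff_pi.1 ha i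
    refine ⟨hs, proj_surjective.forall.2 fun p => ?_⟩
    rw [partialDeriv_proj (hs _), partialDeriv_proj (hs _)]
    simpa only [ha'] using hclosed hpar 0 1 p
  refine ⟨a', b', IsSmooth.const 1, fun _ => one_pos, hdescent hab.contDiff_left hpa ha',
    hdescent hab.contDiff_right hpb hb', proj_surjective.forall.2 fun p i j => ?_⟩
  rw [ha', hb', hab.comp_eq, one_mul]

/-! ### Flows of linear growth -/

section FlowsOfLinearGrowth

open Set Metric

variable {E : Type*} [NormedAddCommGroup E] [NormedSpace ℝ E]

theorem isMIntegralCurveOn_of_hasDerivAt {f : E → E} {c : ℝ → E} {s : Set ℝ}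
    (hc : ∀ t ∈ s, HasDerivAt c (f (c t)) t) :
    IsMIntegralCurveOn (I := modelWithCornersSelf ℝ E) c f s := fun t ht =>
  (hc t ht).hasFDerivAt.hasMFDerivAt.hasMFDerivWithinAt

theorem eqOn_of_hasDerivAt [CompleteSpace E] {f : E → E} (hf : ContDiff ℝ 1 f) {I : Set ℝ}
    (hI : IsOpen I) (hI' : I.OrdConnected) {c d : ℝ → E}
    (hc : ∀ t ∈ I, HasDerivAt c (f (c t)) t) (hd : ∀ t ∈ I, HasDerivAt d (f (d t)) t)
    {t₀ : ℝ} (ht₀ : t₀ ∈ I) (h : c t₀ = d t₀) : EqOn c d I := by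
  intro t ht
  have hmin : min t₀ t ∈ I := by rcases min_choice t₀ t with e | e <;> rwa [e]
  have hmax : max t₀ t ∈ I := by rcases max_choice t₀ t with e | e <;> rwa [e]
  obtain ⟨a, ha, haI⟩ := (hI.eventually_mem hmin).exists_lt
  obtain ⟨b, hb, hbI⟩ := (hI.eventually_mem hmax).exists_gt
  have hsub : Ioo a b ⊆ I := Ioo_subset_Icc_self.trans (hI'.out haI hbI)
  exact isMIntegralCurveOn_Ioo_eqOn_of_contMDiff_boundaryless
    (I := modelWithCornersSelf ℝ E) (v := f)
    ⟨ha.trans_le (min_le_left _ _), (le_max_left _ _).trans_lt hb⟩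
    (contMDiff_vectorSpace_iff_contDiff.2 hf)
    (isMIntegralCurveOn_of_hasDerivAt fun s hs => hc s (hsub hs))
    (isMIntegralCurveOn_of_hasDerivAt fun s hs => hd s (hsub hs)) h
    ⟨ha.trans_le (min_le_right _ _), (le_max_right _ _).trans_lt hb⟩

variable [ProperSpace E] {f : E → E}

theorem exists_lipschitzOnWith_closedBall (hf : ContDiff ℝ 1 f) (x : E) (r : ℝ) :
    ∃ K, LipschitzOnWith K f (closedBall x r) := by
  obtain ⟨K, hK⟩ := (isCompact_closedBall x r).exists_bound_of_continuousOn
    (hf.continuous_fderiv one_ne_zero).continuousOn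
  exact ⟨K.toNNReal, (convex_closedBall x r).lipschitzOnWith_of_nnnorm_fderiv_le
    (fun y _ => hf.differentiable one_ne_zero y) fun y hy => by
      rw [← NNReal.coe_le_coe, coe_nnnorm]
      exact (hK y hy).trans (Real.le_coe_toNNReal K)⟩

/-- On the ball of radius `1 + ‖x‖` about `x` the field is at most `2 C (1 + ‖x‖)`, so a solution
stays in that ball for a time `1 / (2 C)` which is the same for every `x`. -/
theorem exists_forall_Ioo_hasDerivAt_of_linear_growth (hf : ContDiff ℝ 1 f) {C : ℝ} (hC₀ : 0 < C)
    (hC : ∀ x, ‖f x‖ ≤ C * (1 + ‖x‖)) (x : E) : ∃ c : ℝ → E, c 0 = x ∧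
      ∀ t ∈ Ioo (-(1 / (2 * C))) (1 / (2 * C)), HasDerivAt c (f (c t)) t := by
  set ε := 1 / (2 * C)
  have hε : 0 ≤ ε := by positivity
  obtain ⟨K, hK⟩ := exists_lipschitzOnWith_closedBall hf x (1 + ‖x‖)
  have hbound : ∀ y ∈ closedBall x (1 + ‖x‖), ‖f y‖ ≤ 2 * C * (1 + ‖x‖) := by
    intro y hy
    have hy' : ‖y‖ ≤ ‖x‖ + (1 + ‖x‖) := norm_le_norm_add_const_of_dist_le hy
    nlinarith [hC y]
  have hPL : IsPicardLindelof (fun _ => f) (tmin := -ε) (tmax := ε) ⟨0, neg_nonpos.2 hε, hε⟩ x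
      ⟨1 + ‖x‖, by positivity⟩ 0 ⟨2 * C * (1 + ‖x‖), by positivity⟩ K :=
    { lipschitzOnWith := fun _ _ => hK
      continuousOn := fun _ _ => continuousOn_const
      norm_le := fun _ _ => hbound
      mul_max_le := by
        simp only [NNReal.coe_zero, sub_zero, zero_sub, neg_neg, max_self, ε]
        field_simp
        rfl }
  obtain ⟨c, hc₀, hc⟩ := hPL.exists_eq_forall_mem_Icc_hasDerivWithinAt₀
  exact ⟨c, hc₀, fun t ht => (hc t (Ioo_subset_Icc_self ht)).hasDerivAt (Icc_mem_nhds ht.1 ht.2)⟩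

theorem exists_forall_hasDerivAt_of_linear_growth (hf : ContDiff ℝ 1 f) {C : ℝ}
    (hC : ∀ x, ‖f x‖ ≤ C * (1 + ‖x‖)) (x : E) :
    ∃ c : ℝ → E, c 0 = x ∧ ∀ t, HasDerivAt c (f (c t)) t := by
  have hC' : ∀ y, ‖f y‖ ≤ max C 1 * (1 + ‖y‖) := fun y =>
    (hC y).trans (mul_le_mul_of_nonneg_right (le_max_left _ _) (by positivity))
  have hpos : 0 < max C 1 := lt_max_of_lt_right one_pos
  have hlocal := exists_forall_Ioo_hasDerivAt_of_linear_growth hf hpos hC'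
  obtain ⟨c, hc₀, hc⟩ := exists_isMIntegralCurve_of_isMIntegralCurveOn
    (I := modelWithCornersSelf ℝ E) (v := f) (contMDiff_vectorSpace_iff_contDiff.2 hf)
    (show 0 < 1 / (2 * max C 1) by positivity)
    (fun y => (hlocal y).imp fun _ h => ⟨h.1, isMIntegralCurveOn_of_hasDerivAt h.2⟩) x
  refine ⟨c, hc₀, fun t => ?_⟩
  have h : HasFDerivAt c (ContinuousLinearMap.toSpanSingleton ℝ (f (c t))) t :=
    hasMFDerivAt_iff_hasFDerivAt.1 (hc t)
  simpa using h.hasDerivAt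

theorem exists_forall_hasDerivAt_of_time_dependent {F : ℝ × E → E} (hF : ContDiff ℝ 1 F) {C : ℝ}
    (hC : ∀ t x, ‖F (t, x)‖ ≤ C * (1 + ‖x‖)) (x : E) :
    ∃ c : ℝ → E, c 0 = x ∧ ∀ t, HasDerivAt c (F (t, c t)) t := by
  let G : E × ℝ → E × ℝ := fun z => (F (z.2, z.1), 1)
  have hG : ContDiff ℝ 1 G := by fun_prop
  have hbound : ∀ z, ‖G z‖ ≤ (|C| + 1) * (1 + ‖z‖) := by
    intro z
    have hz : ‖z.1‖ ≤ ‖z‖ := norm_fst_le z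
    refine norm_prod_le_iff.2 ⟨?_, ?_⟩
    · calc ‖F (z.2, z.1)‖ ≤ C * (1 + ‖z.1‖) := hC _ _
        _ ≤ |C| * (1 + ‖z‖) := by gcongr; exact le_abs_self C
        _ ≤ (|C| + 1) * (1 + ‖z‖) := by gcongr; linarith
    · rw [norm_one]
      nlinarith [norm_nonneg z, mul_nonneg (abs_nonneg C) (norm_nonneg z), abs_nonneg C]
  obtain ⟨c, hc₀, hc⟩ := exists_forall_hasDerivAt_of_linear_growth hG hbound (x, 0)
  have htime : ∀ t, (c t).2 = t := by
    have hd : ∀ t, HasDerivAt (fun t => (c t).2 - t) 0 t := fun t =>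
      (((ContinuousLinearMap.snd ℝ E ℝ).hasFDerivAt.comp_hasDerivAt t (hc t)).sub
        (hasDerivAt_id t)).congr_deriv (sub_self 1)
    intro t
    have h := is_const_of_deriv_eq_zero (fun t => (hd t).differentiableAt)
      (fun t => (hd t).deriv) t 0
    simp only [hc₀, sub_self] at h
    exact sub_eq_zero.1 h
  refine ⟨fun t => (c t).1, by simp only [hc₀], fun t => ?_⟩
  refine ((ContinuousLinearMap.fst ℝ E ℝ).hasFDerivAt.comp_hasDerivAt t (hc t)).congr_deriv ?_
  simp only [G, ContinuousLinearMap.coe_fst', htime]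

theorem hasDerivAt_log_sub_log {t : ℝ} (ht : t ∈ Ioo (0 : ℝ) 1) :
    HasDerivAt (fun t => Real.log t - Real.log (1 - t)) (t⁻¹ + (1 - t)⁻¹) t := by
  refine ((Real.hasDerivAt_log ht.1.ne').sub
    (((hasDerivAt_id t).const_sub 1).log (sub_pos.2 ht.2).ne')).congr_deriv ?_
  rw [id, neg_div, one_div, sub_neg_eq_add]

theorem sigmoid_log_sub_log {t : ℝ} (ht : t ∈ Ioo (0 : ℝ) 1) :
    Real.sigmoid (Real.log t - Real.log (1 - t)) = t := by
  have h : 1 + (1 - t) / t = t⁻¹ := by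
    have := ht.1.ne'
    field_simp
    ring
  rw [Real.sigmoid_def, neg_sub, Real.exp_sub, Real.exp_log ht.1, Real.exp_log (sub_pos.2 ht.2), h,
    inv_inv]

/-- In the time `τ` with `t = sigmoid τ` the equation `c' = F (t, c) / t` becomes
`c' = (1 - t) F (t, c)`, which has no singularity. -/
theorem exists_hasDerivAt_inv_smul {F : ℝ × E → E} (hF : ContDiff ℝ 1 F) {C : ℝ}
    (hC : ∀ t ∈ Ioo (0 : ℝ) 1, ∀ x, ‖F (t, x)‖ ≤ C * (1 + ‖x‖)) (x : E) :
    ∃ c : ℝ → E, c (1 / 2) = x ∧ ∀ t ∈ Ioo (0 : ℝ) 1, HasDerivAt c (t⁻¹ • F (t, c t)) t := by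
  have hσ : ContDiff ℝ 1 Real.sigmoid := contDiff_sigmoid.of_le le_top
  let G : ℝ × E → E := fun z => (1 - Real.sigmoid z.1) • F (Real.sigmoid z.1, z.2)
  have hbound : ∀ τ y, ‖G (τ, y)‖ ≤ C * (1 + ‖y‖) := by
    intro τ y
    have h₀ := Real.sigmoid_pos τ
    have h₁ := Real.sigmoid_lt_one τ
    rw [norm_smul, Real.norm_of_nonneg (by linarith)]
    exact (mul_le_of_le_one_left (norm_nonneg _) (by linarith)).trans (hC _ ⟨h₀, h₁⟩ y)
  obtain ⟨c, hc₀, hc⟩ :=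
    exists_forall_hasDerivAt_of_time_dependent (F := G) (by fun_prop) hbound x
  refine ⟨fun t => c (Real.log t - Real.log (1 - t)), by norm_num [hc₀], fun t ht => ?_⟩
  refine ((hc _).scomp t (hasDerivAt_log_sub_log ht)).congr_deriv ?_
  simp only [G, sigmoid_log_sub_log ht, smul_smul]
  congr 1
  have := ht.1.ne'
  have := (sub_pos.2 ht.2).ne'
  field_simp
  ring

end FlowsOfLinearGrowth

theorem contDiff_comp_proj {X : Torus → Plane} (hX : ∀ i, IsSmooth fun x => X x i) :
    ContDiff ℝ ∞ fun p => X (proj p) :=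
  contDiff_pi.2 hX

theorem exists_norm_le {X : Torus → Plane} (hX : ∀ i, IsSmooth fun x => X x i) :
    ∃ C, 0 ≤ C ∧ ∀ x, ‖X x‖ ≤ C := by
  choose M hM₀ hM using fun i => (hX i).exists_abs_le
  have hsum : 0 ≤ ∑ i, M i := Finset.sum_nonneg fun i _ => hM₀ i
  exact ⟨∑ i, M i, hsum, fun x => (pi_norm_le_iff_of_nonneg hsum).2 fun i =>
    (hM i x).trans (Finset.single_le_sum (fun j _ => hM₀ j) (Finset.mem_univ i))⟩

theorem exists_integralCurve {X : Torus → Plane} (hX : ∀ i, IsSmooth fun x => X x i) (p₀ : Plane) :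
    ∃ c : ℝ → Plane, c 0 = p₀ ∧ ∀ t, HasDerivAt c (X (proj (c t))) t := by
  obtain ⟨C, hC₀, hC⟩ := exists_norm_le hX
  exact exists_forall_hasDerivAt_of_linear_growth (f := fun p => X (proj p))
    ((contDiff_comp_proj hX).of_le (by exact_mod_cast le_top))
    (fun p => (hC _).trans (le_mul_of_one_le_right hC₀ (by linarith [norm_nonneg p]))) p₀

theorem exists_integralCurve_singular {X Y : Torus → Plane} (hX : ∀ i, IsSmooth fun x => X x i)
    (hY : ∀ i, IsSmooth fun x => Y x i) {A B : ℝ → ℝ} (hA : ContDiff ℝ 1 A) (hB : ContDiff ℝ 1 B)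
    (p₀ : Plane) : ∃ c : ℝ → Plane, c (1 / 2) = p₀ ∧ ∀ t ∈ Set.Ioo (0 : ℝ) 1,
      HasDerivAt c (A t • X (proj (c t)) + (B t / t) • Y (proj (c t))) t := by
  obtain ⟨C, -, hC⟩ := exists_norm_le hX
  obtain ⟨D, -, hD⟩ := exists_norm_le hY
  obtain ⟨M, hM⟩ := isCompact_Icc.exists_bound_of_continuousOn hA.continuous.continuousOn
    (s := Set.Icc 0 1)
  obtain ⟨N, hN⟩ := isCompact_Icc.exists_bound_of_continuousOn hB.continuous.continuousOn
    (s := Set.Icc 0 1)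
  have hX₁ : ContDiff ℝ 1 fun p => X (proj p) :=
    (contDiff_comp_proj hX).of_le (by exact_mod_cast le_top)
  have hY₁ : ContDiff ℝ 1 fun p => Y (proj p) :=
    (contDiff_comp_proj hY).of_le (by exact_mod_cast le_top)
  let F : ℝ × Plane → Plane := fun z =>
    (z.1 * A z.1) • X (proj z.2) + B z.1 • Y (proj z.2)
  have hF : ContDiff ℝ 1 F :=
    ((contDiff_fst.mul (hA.comp contDiff_fst)).smul (hX₁.comp contDiff_snd)).add
      ((hB.comp contDiff_fst).smul (hY₁.comp contDiff_snd))
  have hbound : ∀ t ∈ Set.Ioo (0 : ℝ) 1, ∀ p, ‖F (t, p)‖ ≤ (M * C + N * D) * (1 + ‖p‖) := by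
    intro t ht p
    have ht' := Set.Ioo_subset_Icc_self ht
    have hM' : ‖t * A t‖ ≤ M := by
      rw [norm_mul, Real.norm_of_nonneg ht.1.le]
      exact (mul_le_of_le_one_left (norm_nonneg _) ht.2.le).trans (hM t ht')
    have hsum : ‖F (t, p)‖ ≤ M * C + N * D := by
      refine norm_add_le_of_le ?_ ?_ <;> rw [norm_smul]
      · exact mul_le_mul hM' (hC _) (norm_nonneg _) ((norm_nonneg _).trans hM')
      · exact mul_le_mul (hN t ht') (hD _) (norm_nonneg _) ((norm_nonneg _).trans (hN t ht'))
    exact hsum.trans (le_mul_of_one_le_right ((norm_nonneg _).trans hsum)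
      (by linarith [norm_nonneg p]))
  obtain ⟨c, hc₀, hc⟩ := exists_hasDerivAt_inv_smul hF hbound p₀
  refine ⟨c, hc₀, fun t ht => (hc t ht).congr_deriv ?_⟩
  simp only [F, smul_add, smul_smul, inv_mul_cancel_left₀ ht.1.ne', div_eq_inv_mul]

theorem HasVelocityAt.hasDerivAt_toCircle {γ : ℝ → Torus} {v : Plane} {t : ℝ}
    (h : HasVelocityAt γ v t) (k : Fin 2) :
    HasDerivAt (fun s => (AddCircle.toCircle (γ s k) : ℂ))
      (2 * Real.pi * Complex.I * v k * AddCircle.toCircle (γ t k)) t := by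
  obtain ⟨c, hc, hcγ⟩ := h
  have htoCircle : ∀ s, proj (c s) = γ s →
      (AddCircle.toCircle (γ s k) : ℂ) = Complex.exp (2 * Real.pi * Complex.I * c s k) := by
    intro s hs
    rw [← hs]
    simp only [proj, AddCircle.toCircle_apply_mk, Circle.coe_exp]
    congr 1
    push_cast
    ring
  have hck : HasDerivAt (fun s => ((c s k : ℝ) : ℂ)) (v k : ℂ) t :=
    ((hasDerivAt_pi.1 hc) k).ofReal_comp
  rw [htoCircle t hcγ.self_of_nhds]
  refine ((hck.const_mul (2 * Real.pi * Complex.I)).cexp.congr_of_eventuallyEq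
    (hcγ.mono htoCircle)).congr_deriv ?_
  ring

theorem HasVelocityAt.continuousAt {γ : ℝ → Torus} {v : Plane} {t : ℝ}
    (h : HasVelocityAt γ v t) : ContinuousAt γ t := by
  obtain ⟨c, hc, hγ⟩ := h
  exact (isOpenQuotientMap_proj.continuous.continuousAt.comp hc.continuousAt).congr hγ

theorem HasVelocityAt.unique {γ γ' : ℝ → Torus} {v v' : Plane} {t : ℝ}
    (h : HasVelocityAt γ v t) (h' : HasVelocityAt γ' v' t) (e : γ =ᶠ[𝓝 t] γ') : v = v' := by
  funext k
  have hderiv := (h.hasDerivAt_toCircle k).unique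
    ((h'.hasDerivAt_toCircle k).congr_of_eventuallyEq
      (f₁ := fun s => (AddCircle.toCircle (γ s k) : ℂ)) (e.mono fun s hs => by simp only [hs]))
  rw [← e.self_of_nhds] at hderiv
  exact_mod_cast mul_left_cancel₀ Complex.two_pi_I_ne_zero
    (mul_right_cancel₀ (Circle.coe_ne_zero _) hderiv)

theorem hasVelocityAt_proj {c : ℝ → Plane} {v : Plane} {t : ℝ} (hc : HasDerivAt c v t) :
    HasVelocityAt (fun s => proj (c s)) v t :=
  ⟨c, hc, Filter.Eventually.of_forall fun _ => rfl⟩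

/-- The quotient of the images of both curves under `ℝ/ℤ ≃ S¹ ⊆ ℂ` has derivative zero. -/
theorem eqOn_of_hasVelocityAt {I : Set ℝ} (hI : IsOpen I) (hI' : I.OrdConnected)
    {γ γ' : ℝ → Torus} {v : ℝ → Plane} (hγ : ∀ t ∈ I, HasVelocityAt γ (v t) t)
    (hγ' : ∀ t ∈ I, HasVelocityAt γ' (v t) t) {t₀ : ℝ} (ht₀ : t₀ ∈ I) (h : γ t₀ = γ' t₀) :
    Set.EqOn γ γ' I := by
  intro t ht
  funext k
  let z : (ℝ → Torus) → ℝ → ℂ := fun δ s => AddCircle.toCircle (δ s k)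
  have hz : ∀ δ s, z δ s ≠ 0 := fun _ _ => Circle.coe_ne_zero _
  have hderiv : ∀ s ∈ I, HasDerivAt (fun s => z γ s / z γ' s) 0 s := by
    intro s hs
    refine (((hγ s hs).hasDerivAt_toCircle k).fun_div ((hγ' s hs).hasDerivAt_toCircle k)
      (hz γ' s)).congr_deriv ?_
    exact div_eq_zero_iff.2 (Or.inl (by ring))
  have hconst : z γ t / z γ' t = z γ t₀ / z γ' t₀ :=
    hI.is_const_of_deriv_eq_zero hI'.isPreconnected (𝕜 := ℝ)
      (fun s hs => (hderiv s hs).differentiableAt.differentiableWithinAt)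
      (fun s hs => (hderiv s hs).deriv) ht ht₀
  have hstart : z γ t₀ / z γ' t₀ = 1 := by
    simp only [z, h]
    exact div_self (Circle.coe_ne_zero _)
  exact AddCircle.injective_toCircle one_ne_zero
    (Circle.ext ((div_eq_one_iff_eq (hz γ' t)).1 (hconst.trans hstart)))

theorem exists_lift {I : Set ℝ} (hI : IsOpen I) (hI' : I.OrdConnected) {γ : ℝ → Torus}
    {v : ℝ → Plane} (hγ : ∀ t ∈ I, HasVelocityAt γ (v t) t) (hv : ContinuousOn v I) {t₀ : ℝ}
    (ht₀ : t₀ ∈ I) :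
    ∃ c : ℝ → Plane, ∀ t ∈ I, HasDerivAt c (v t) t ∧ proj (c t) = γ t := by
  obtain ⟨p₀, hp₀⟩ := proj_surjective (γ t₀)
  let c : ℝ → Plane := fun t => p₀ + ∫ s in t₀..t, v s
  have hc : ∀ t ∈ I, HasDerivAt c (v t) t := by
    intro t ht
    have hsub : Set.uIcc t₀ t ⊆ I := hI'.uIcc_subset ht₀ ht
    exact (intervalIntegral.integral_hasDerivAt_right ((hv.mono hsub).intervalIntegrable)
      (hv.stronglyMeasurableAtFilter hI t ht) (hv.continuousAt (hI.mem_nhds ht))).const_add p₀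
  have hstart : proj (c t₀) = γ t₀ := by
    simp only [c, intervalIntegral.integral_same, add_zero, hp₀]
  exact ⟨c, fun t ht => ⟨hc t ht, eqOn_of_hasVelocityAt hI hI'
    (fun s hs => hasVelocityAt_proj (hc s hs)) hγ ht₀ hstart ht⟩⟩

/-! ### Geodesics of metrics with a closed null coframe -/

theorem hasDerivAt_comp_proj_curve {f : Torus → ℝ} (hf : IsSmooth f) {c : ℝ → Plane}
    {v : Plane} {t : ℝ} (hc : HasDerivAt c v t) :
    HasDerivAt (fun s => f (proj (c s))) (∑ i, partialDeriv i f (proj (c t)) * v i) t := by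
  simpa only [partialDeriv_proj hf] using
    hasDerivAt_comp_curve (hf.differentiableAt (c t)) hc

theorem IsClosedForm.hasDerivAt_comp_proj_curve {a : Torus → Plane} (ha : IsClosedForm a)
    {c : ℝ → Plane} {v : Plane} {t : ℝ} (hc : HasDerivAt c v t) (l : Fin 2) :
    HasDerivAt (fun s => a (proj (c s)) l)
      (∑ i, partialDeriv l (fun y => a y i) (proj (c t)) * v i) t := by
  simpa only [ha.partialDeriv_comm l] using LorentzTorus.hasDerivAt_comp_proj_curve (ha.smooth l) hc

namespace LorentzMetric

/-- The acceleration `-Γ(u, u)` of the geodesic through `x` with velocity `u`. -/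
def accel (g : LorentzMetric) (x : Torus) (u : Plane) : Plane :=
  fun k => -∑ i, ∑ j, g.christoffel k i j x * u i * u j

variable {g : LorentzMetric} {c v : ℝ → Plane} {t : ℝ}

theorem accel_smooth (g : LorentzMetric) :
    ContDiff ℝ ∞ fun z : Plane × Plane => g.accel (proj z.1) z.2 := by
  refine contDiff_pi.2 fun k => ContDiff.neg <| ContDiff.sum fun i _ => ContDiff.sum fun j _ => ?_
  have hΓ : ContDiff ℝ ∞ fun z : Plane × Plane => g.christoffel k i j (proj z.1) :=
    ContDiff.comp (g := fun p => g.christoffel k i j (proj p)) (g.christoffel_smooth k i j)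
      contDiff_fst
  fun_prop

theorem sum_comp_mul_accel (x : Torus) (u : Plane) (l : Fin 2) :
    ∑ k, g.comp x l k * g.accel x u k
      = 1 / 2 * ∑ i, ∑ j, partialDeriv l (fun y => g.comp y i j) x * u i * u j
        - ∑ i, ∑ j, partialDeriv i (fun y => g.comp y l j) x * u i * u j := by
  have hΓ (i j : Fin 2) := g.sum_comp_mul_christoffel l i j x
  simp only [Fin.sum_univ_two, g.comp_symm _ _ l] at hΓ
  simp only [accel, Fin.sum_univ_two]
  linear_combination -(u 0 * u 0) * hΓ 0 0 - u 0 * u 1 * hΓ 0 1 - u 1 * u 0 * hΓ 1 0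
    - u 1 * u 1 * hΓ 1 1

/-- The hypothesis is the Euler-Lagrange equation of the energy `g(v, v) / 2`. -/
theorem hasDerivAt_accel_of_momentum (hc : HasDerivAt c (v t) t) (hv : DifferentiableAt ℝ v t)
    (hmom : ∀ l, HasDerivAt (fun s => ∑ j, g.comp (proj (c s)) l j * v s j)
      (1 / 2 * ∑ i, ∑ j, partialDeriv l (fun y => g.comp y i j) (proj (c t)) * v t i * v t j) t) :
    HasDerivAt v (g.accel (proj (c t)) (v t)) t := by
  let x := proj (c t)
  have hvj (j : Fin 2) : HasDerivAt (fun s => v s j) (deriv v t j) t :=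
    hasDerivAt_pi.1 hv.hasDerivAt j
  have hkernel : (g.comp x).mulVec (deriv v t - g.accel x (v t)) = 0 := by
    funext l
    have hprod := HasDerivAt.fun_sum (u := Finset.univ) fun j _ =>
      (hasDerivAt_comp_proj_curve (g.smooth l j) hc).fun_mul (hvj j)
    have hEL := hprod.unique (hmom l)
    have haccel := sum_comp_mul_accel (g := g) x (v t) l
    simp only [Fin.sum_univ_two] at hEL haccel
    simp only [Matrix.mulVec, dotProduct, Fin.sum_univ_two, Pi.sub_apply, Pi.zero_apply]
    linear_combination hEL - haccel
  have hderiv := Matrix.eq_zero_of_mulVec_eq_zero (g.lorentzian x).ne hkernel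
  exact sub_eq_zero.1 hderiv ▸ hv.hasDerivAt

theorem geodesic_unique {I : Set ℝ} (hI : IsOpen I) (hI' : I.OrdConnected) {d w : ℝ → Plane}
    (hc : ∀ t ∈ I, HasDerivAt c (v t) t ∧ HasDerivAt v (g.accel (proj (c t)) (v t)) t)
    (hd : ∀ t ∈ I, HasDerivAt d (w t) t ∧ HasDerivAt w (g.accel (proj (d t)) (w t)) t)
    {t₀ : ℝ} (ht₀ : t₀ ∈ I) (hcd : c t₀ = d t₀) (hvw : v t₀ = w t₀) : Set.EqOn c d I := by
  let f : Plane × Plane → Plane × Plane := fun z => (z.2, g.accel (proj z.1) z.2)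
  have hf : ContDiff ℝ 1 f :=
    contDiff_snd.prodMk (g.accel_smooth.of_le (by exact_mod_cast le_top))
  have heq := eqOn_of_hasDerivAt hf hI hI' (c := fun t => (c t, v t)) (d := fun t => (d t, w t))
    (fun t ht => (hc t ht).1.prodMk (hc t ht).2) (fun t ht => (hd t ht).1.prodMk (hd t ht).2) ht₀
    (Prod.ext hcd hvw)
  exact fun t ht => congrArg Prod.fst (heq ht)

theorem isGeodesicOn_proj {I : Set ℝ} (hc : ∀ t ∈ I, HasDerivAt c (v t) t ∧
      HasDerivAt v (g.accel (proj (c t)) (v t)) t) :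
    g.IsGeodesicOn (fun t => proj (c t)) v I := fun t ht =>
  ⟨hasVelocityAt_proj (hc t ht).1, hasDerivAt_pi.1 (hc t ht).2⟩

theorem isComplete_of_forall_exists_geodesic
    (h : ∀ p₀ v₀ : Plane, ∃ c v : ℝ → Plane, c 0 = p₀ ∧ v 0 = v₀ ∧ ∀ t, HasDerivAt c (v t) t ∧
      HasDerivAt v (g.accel (proj (c t)) (v t)) t) : g.IsComplete := by
  intro I γ v hI hI' ⟨t₀, ht₀⟩ hγ
  have hv : ∀ t ∈ I, HasDerivAt v (g.accel (γ t) (v t)) t := fun t ht =>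
    hasDerivAt_pi.2 (hγ t ht).2
  obtain ⟨c, hc⟩ := exists_lift hI hI' (fun t ht => (hγ t ht).1)
    (fun t ht => (hv t ht).continuousAt.continuousWithinAt) ht₀
  obtain ⟨d, w, hd₀, hw₀, hd⟩ := h (c t₀) (v t₀)
  have hshift : ∀ t, HasDerivAt (fun s => d (s - t₀)) (w (t - t₀)) t ∧
      HasDerivAt (fun s => w (s - t₀)) (g.accel (proj (d (t - t₀))) (w (t - t₀))) t := fun t =>
    ⟨(hd (t - t₀)).1.comp_sub_const t t₀, (hd (t - t₀)).2.comp_sub_const t t₀⟩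
  have heq : Set.EqOn (fun t => d (t - t₀)) c I :=
    geodesic_unique hI hI' (v := fun t => w (t - t₀)) (fun t _ => hshift t)
      (fun t ht => ⟨(hc t ht).1, (hc t ht).2.symm ▸ hv t ht⟩) ht₀
      (by simp only [sub_self, hd₀]) (by simp only [sub_self, hw₀])
  exact ⟨fun t => proj (d (t - t₀)), fun t => w (t - t₀), isGeodesicOn_proj fun t _ => hshift t,
    fun t ht => (congrArg proj (heq ht)).trans (hc t ht).2⟩

end LorentzMetric

theorem exists_momentum_curve {X Y : Torus → Plane} {φ ψ : Torus → ℝ}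
    (hX : ∀ i, IsSmooth fun x => X x i) (hY : ∀ i, IsSmooth fun x => Y x i) (hφ : IsSmooth φ)
    (hψ : IsSmooth ψ) (p₀ : Plane) (P₀ Q₀ : ℝ) : ∃ (c : ℝ → Plane) (P Q : ℝ → ℝ),
      c 0 = p₀ ∧ P 0 = P₀ ∧ Q 0 = Q₀ ∧ ∀ t,
        HasDerivAt c (Q t • X (proj (c t)) + P t • Y (proj (c t))) t ∧
        HasDerivAt P (φ (proj (c t))) t ∧ HasDerivAt Q (ψ (proj (c t))) t := by
  obtain ⟨CX, hCX₀, hCX⟩ := exists_norm_le hX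
  obtain ⟨CY, hCY₀, hCY⟩ := exists_norm_le hY
  obtain ⟨Cφ, hCφ₀, hCφ⟩ := hφ.exists_abs_le
  obtain ⟨Cψ, hCψ₀, hCψ⟩ := hψ.exists_abs_le
  let f : Plane × ℝ × ℝ → Plane × ℝ × ℝ := fun z =>
    (z.2.2 • X (proj z.1) + z.2.1 • Y (proj z.1), φ (proj z.1), ψ (proj z.1))
  have hf : ContDiff ℝ ∞ f :=
    ((contDiff_snd.snd.smul ((contDiff_comp_proj hX).comp contDiff_fst)).add
      (contDiff_snd.fst.smul ((contDiff_comp_proj hY).comp contDiff_fst))).prodMk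
      ((ContDiff.comp (g := fun p => φ (proj p)) hφ contDiff_fst).prodMk
        (ContDiff.comp (g := fun p => ψ (proj p)) hψ contDiff_fst))
  have hbound : ∀ z, ‖f z‖ ≤ (CX + CY + Cφ + Cψ) * (1 + ‖z‖) := by
    intro z
    have hz := norm_nonneg z
    have hP : ‖z.2.1‖ ≤ ‖z‖ := (norm_fst_le z.2).trans (norm_snd_le z)
    have hQ : ‖z.2.2‖ ≤ ‖z‖ := (norm_snd_le z.2).trans (norm_snd_le z)
    have hvel : ‖z.2.2 • X (proj z.1) + z.2.1 • Y (proj z.1)‖ ≤ ‖z‖ * CX + ‖z‖ * CY := by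
      refine norm_add_le_of_le ?_ ?_ <;> rw [norm_smul]
      exacts [mul_le_mul hQ (hCX _) (norm_nonneg _) hz, mul_le_mul hP (hCY _) (norm_nonneg _) hz]
    refine norm_prod_le_iff.2 ⟨hvel.trans ?_, norm_prod_le_iff.2 ⟨(hCφ _).trans ?_,
      (hCψ _).trans ?_⟩⟩ <;> nlinarith
  obtain ⟨z, hz₀, hz⟩ := exists_forall_hasDerivAt_of_linear_growth
    (hf.of_le (by exact_mod_cast le_top)) hbound (p₀, P₀, Q₀)
  refine ⟨fun t => (z t).1, fun t => (z t).2.1, fun t => (z t).2.2, by simp only [hz₀],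
    by simp only [hz₀], by simp only [hz₀], fun t => ?_⟩
  have hfst := (ContinuousLinearMap.fst ℝ Plane (ℝ × ℝ)).hasFDerivAt.comp_hasDerivAt t (hz t)
  have hsnd := (ContinuousLinearMap.snd ℝ Plane (ℝ × ℝ)).hasFDerivAt.comp_hasDerivAt t (hz t)
  exact ⟨hfst, (ContinuousLinearMap.fst ℝ ℝ ℝ).hasFDerivAt.comp_hasDerivAt t hsnd,
    (ContinuousLinearMap.snd ℝ ℝ ℝ).hasFDerivAt.comp_hasDerivAt t hsnd⟩

/-- The covector `df` at `x`. -/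
def differential (f : Torus → ℝ) (x : Torus) : Plane := fun k => partialDeriv k f x

theorem dualField_eq_smul_add (a b : Torus → Plane) (r s : ℝ) (x : Torus) :
    dualField a b r s x = r • dualField a b 1 0 x + s • dualField a b 0 1 x := by
  refine funext (Fin.forall_fin_two.2 ⟨?_, ?_⟩) <;>
  · simp only [dualField, Matrix.cons_val_zero, Matrix.cons_val_one, Pi.add_apply, Pi.smul_apply,
      smul_eq_mul]
    ring

theorem dualField_dotProduct {a b : Torus → Plane} {x : Torus} (h : wedge (a x) (b x) ≠ 0)
    (u : Plane) : dualField a b (a x ⬝ᵥ u) (b x ⬝ᵥ u) x = u := by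
  refine sub_eq_zero.1 (eq_zero_of_dotProduct_eq_zero h ?_ ?_) <;>
    rw [dotProduct_comm, dotProduct_sub]
  · rw [left_dotProduct_dualField h, sub_self]
  · rw [right_dotProduct_dualField h, sub_self]

theorem eq_dotProduct_dualField_smul_add {a b : Torus → Plane} {x : Torus}
    (h : wedge (a x) (b x) ≠ 0) (w : Plane) :
    w = (w ⬝ᵥ dualField a b 1 0 x) • a x + (w ⬝ᵥ dualField a b 0 1 x) • b x := by
  refine funext (Fin.forall_fin_two.2 ⟨?_, ?_⟩) <;>
  · simp only [dualField, dotProduct, Fin.sum_univ_two, Matrix.cons_val_zero, Matrix.cons_val_one,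
      Pi.add_apply, Pi.smul_apply, smul_eq_mul]
    field_simp
    simp only [wedge]
    ring

theorem differentiableAt_dualField_comp_proj {a b : Torus → Plane}
    (ha : ∀ i, IsSmooth fun x => a x i) (hb : ∀ i, IsSmooth fun x => b x i)
    (hw : ∀ x, wedge (a x) (b x) ≠ 0) {r s : ℝ → ℝ} {c : ℝ → Plane} {t : ℝ}
    (hr : DifferentiableAt ℝ r t) (hs : DifferentiableAt ℝ s t) (hc : DifferentiableAt ℝ c t) :
    DifferentiableAt ℝ (fun t => dualField a b (r t) (s t) (proj (c t))) t := by
  have hconst (r s : ℝ) : DifferentiableAt ℝ (fun t => dualField a b r s (proj (c t))) t :=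
    DifferentiableAt.comp t (g := fun p => dualField a b r s (proj p))
      ((contDiff_comp_proj (isSmooth_dualField ha hb hw r s)).differentiable (by simp) _) hc
  simp only [dualField_eq_smul_add a b (r _)]
  exact (hr.smul (hconst 1 0)).add (hs.smul (hconst 0 1))

namespace LorentzMetric.IsNullCoframe

variable {g : LorentzMetric} {Ω : Torus → ℝ} {a b : Torus → Plane} {c v : ℝ → Plane} {t : ℝ}

theorem sum_comp_mul (h : g.IsNullCoframe Ω a b) (x : Torus) (u : Plane) (l : Fin 2) :
    ∑ j, g.comp x l j * u j = Ω x * (b x ⬝ᵥ u) * a x l + Ω x * (a x ⬝ᵥ u) * b x l := by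
  simp only [h.comp_eq, dotProduct, Fin.sum_univ_two]
  ring

theorem sum_partialDeriv_comp_mul (h : g.IsNullCoframe Ω a b) (x : Torus) (u : Plane)
    (l : Fin 2) :
    1 / 2 * ∑ i, ∑ j, partialDeriv l (fun y => g.comp y i j) x * u i * u j
      = partialDeriv l Ω x * (a x ⬝ᵥ u) * (b x ⬝ᵥ u)
        + Ω x * (b x ⬝ᵥ u) * (∑ i, partialDeriv l (fun y => a y i) x * u i)
        + Ω x * (a x ⬝ᵥ u) * ∑ i, partialDeriv l (fun y => b y i) x * u i := by
  simp only [h.partialDeriv_comp, h.left.partialDeriv_comm l, h.right.partialDeriv_comm l,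
    dotProduct, Fin.sum_univ_two]
  ring

theorem hasDerivAt_accel (h : g.IsNullCoframe Ω a b) {P Q : ℝ → ℝ} {e : ℝ}
    (hc : HasDerivAt c (v t) t) (hv : DifferentiableAt ℝ v t)
    (ha : ∀ s, Ω (proj (c s)) * (a (proj (c s)) ⬝ᵥ v s) = Q s)
    (hb : ∀ s, Ω (proj (c s)) * (b (proj (c s)) ⬝ᵥ v s) = P s)
    (hP : HasDerivAt P (e / Ω (proj (c t))
      * (differential Ω (proj (c t)) ⬝ᵥ dualField a b 1 0 (proj (c t)))) t)
    (hQ : HasDerivAt Q (e / Ω (proj (c t))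
      * (differential Ω (proj (c t)) ⬝ᵥ dualField a b 0 1 (proj (c t)))) t)
    (henergy : P t * Q t = e * Ω (proj (c t))) :
    HasDerivAt v (g.accel (proj (c t)) (v t)) t := by
  refine hasDerivAt_accel_of_momentum hc hv fun l => ?_
  simp only [h.sum_comp_mul, h.sum_partialDeriv_comp_mul, ha, hb]
  refine ((hP.fun_mul (h.left.hasDerivAt_comp_proj_curve hc l)).fun_add
    (hQ.fun_mul (h.right.hasDerivAt_comp_proj_curve hc l))).congr_deriv ?_
  have hΩ := (h.pos (proj (c t))).ne'
  have hdΩ := congrFun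
    (eq_dotProduct_dualField_smul_add (h.wedge_ne_zero (proj (c t)))
      (differential Ω (proj (c t)))) l
  have hPQ : (a (proj (c t)) ⬝ᵥ v t) * (b (proj (c t)) ⬝ᵥ v t) = e / Ω (proj (c t)) := by
    rw [eq_div_iff hΩ]
    refine mul_left_cancel₀ hΩ ?_
    linear_combination henergy + P t * ha t
      + Ω (proj (c t)) * (a (proj (c t)) ⬝ᵥ v t) * hb t
  simp only [Pi.add_apply, Pi.smul_apply, smul_eq_mul] at hdΩ
  rw [show partialDeriv l Ω (proj (c t)) = differential Ω (proj (c t)) l from rfl]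
  linear_combination -(e / Ω (proj (c t))) * hdΩ - differential Ω (proj (c t)) l * hPQ

/-- With `v = (Q X + P Y) / Ω` for the fields `X`, `Y` dual to `a`, `b`, half the energy is
`e = P Q / Ω`. Once `e` is treated as a constant, the geodesic equation is affine in `(P, Q)`, hence
solvable for all times; the solution does conserve `P Q / Ω`. -/
theorem exists_momentum_geodesic (h : g.IsNullCoframe Ω a b) (p₀ : Plane) (P₀ Q₀ e : ℝ)
    (he : P₀ * Q₀ = e * Ω (proj p₀)) : ∃ (c : ℝ → Plane) (P Q : ℝ → ℝ),
      c 0 = p₀ ∧ P 0 = P₀ ∧ Q 0 = Q₀ ∧ ∀ t,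
        HasDerivAt c ((Ω (proj (c t)))⁻¹ • dualField a b (Q t) (P t) (proj (c t))) t ∧
        HasDerivAt P (e / Ω (proj (c t))
          * (differential Ω (proj (c t)) ⬝ᵥ dualField a b 1 0 (proj (c t)))) t ∧
        HasDerivAt Q (e / Ω (proj (c t))
          * (differential Ω (proj (c t)) ⬝ᵥ dualField a b 0 1 (proj (c t)))) t ∧
        P t * Q t = e * Ω (proj (c t)) := by
  have hX := isSmooth_dualField h.left.smooth h.right.smooth h.wedge_ne_zero 1 0
  have hY := isSmooth_dualField h.left.smooth h.right.smooth h.wedge_ne_zero 0 1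
  have hΩ := fun x => (h.pos x).ne'
  have hforce {X : Torus → Plane} (hX : ∀ k, IsSmooth fun x => X x k) :
      IsSmooth fun x => e / Ω x * (differential Ω x ⬝ᵥ X x) :=
    ((IsSmooth.const e).div h.smooth hΩ).mul
      (IsSmooth.sum fun k => (h.smooth.partialDeriv k).mul (hX k))
  obtain ⟨c, P, Q, hc₀, hP₀, hQ₀, hcPQ⟩ := exists_momentum_curve
    (X := fun x => (Ω x)⁻¹ • dualField a b 1 0 x) (Y := fun x => (Ω x)⁻¹ • dualField a b 0 1 x)
    (fun k => (h.smooth.inv hΩ).mul (hX k)) (fun k => (h.smooth.inv hΩ).mul (hY k))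
    (hforce hX) (hforce hY) p₀ P₀ Q₀
  have hc (t : ℝ) :
      HasDerivAt c ((Ω (proj (c t)))⁻¹ • dualField a b (Q t) (P t) (proj (c t))) t := by
    refine (hcPQ t).1.congr_deriv ?_
    rw [dualField_eq_smul_add a b (Q t), smul_add, smul_comm (Q t), smul_comm (P t)]
  have hconst (t : ℝ) : HasDerivAt (fun s => P s * Q s - e * Ω (proj (c s))) 0 t := by
    refine (((hcPQ t).2.1.mul (hcPQ t).2.2).sub
      ((hasDerivAt_comp_proj_curve h.smooth (hc t)).const_mul e)).congr_deriv ?_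
    rw [dualField_eq_smul_add a b (Q t)]
    simp only [differential, dotProduct, Fin.sum_univ_two, Pi.smul_apply, Pi.add_apply, smul_eq_mul]
    ring
  refine ⟨c, P, Q, hc₀, hP₀, hQ₀, fun t => ⟨hc t, (hcPQ t).2.1, (hcPQ t).2.2, ?_⟩⟩
  have hconserved := is_const_of_deriv_eq_zero (fun s => (hconst s).differentiableAt)
    (fun s => (hconst s).deriv) t 0
  rw [hc₀, hP₀, hQ₀, he, sub_self] at hconserved
  exact sub_eq_zero.1 hconserved

theorem exists_geodesic (h : g.IsNullCoframe Ω a b) (p₀ v₀ : Plane) :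
    ∃ c v : ℝ → Plane, c 0 = p₀ ∧ v 0 = v₀ ∧ ∀ t, HasDerivAt c (v t) t ∧
      HasDerivAt v (g.accel (proj (c t)) (v t)) t := by
  have hw := h.wedge_ne_zero
  have hΩ := fun x => (h.pos x).ne'
  let x₀ := proj p₀
  obtain ⟨c, P, Q, hc₀, hP₀, hQ₀, hcPQ⟩ := h.exists_momentum_geodesic p₀
    (Ω x₀ * (b x₀ ⬝ᵥ v₀)) (Ω x₀ * (a x₀ ⬝ᵥ v₀)) (Ω x₀ * (a x₀ ⬝ᵥ v₀) * (b x₀ ⬝ᵥ v₀)) (by ring)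
  let v : ℝ → Plane := fun t => (Ω (proj (c t)))⁻¹ • dualField a b (Q t) (P t) (proj (c t))
  have hv (t : ℝ) : DifferentiableAt ℝ v t := by
    have hinv : DifferentiableAt ℝ (fun t => (Ω (proj (c t)))⁻¹) t :=
      (hasDerivAt_comp_proj_curve h.smooth (hcPQ t).1).differentiableAt.inv (hΩ _)
    exact hinv.smul (differentiableAt_dualField_comp_proj h.left.smooth h.right.smooth hw
      (hcPQ t).2.2.1.differentiableAt (hcPQ t).2.1.differentiableAt (hcPQ t).1.differentiableAt)
  refine ⟨c, v, hc₀, ?_, fun t => ⟨(hcPQ t).1, h.hasDerivAt_accel (hcPQ t).1 (hv t) (fun s => ?_)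
    (fun s => ?_) (hcPQ t).2.1 (hcPQ t).2.2.1 (hcPQ t).2.2.2⟩⟩
  · simp only [v, hc₀, hP₀, hQ₀]
    rw [dualField_eq_smul_add, mul_smul, mul_smul, ← smul_add, ← dualField_eq_smul_add,
      inv_smul_smul₀ (hΩ _), dualField_dotProduct (hw _)]
  · rw [dotProduct_smul, left_dotProduct_dualField (hw _), smul_eq_mul, mul_inv_cancel_left₀ (hΩ _)]
  · rw [dotProduct_smul, right_dotProduct_dualField (hw _), smul_eq_mul,
      mul_inv_cancel_left₀ (hΩ _)]

theorem isComplete (h : g.IsNullCoframe Ω a b) : g.IsComplete :=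
  isComplete_of_forall_exists_geodesic h.exists_geodesic

end LorentzMetric.IsNullCoframe

/-! ### The topology on metrics -/

theorem IsSmooth.exists_norm_iteratedFDeriv_le {f : Torus → ℝ} (hf : IsSmooth f) (k : ℕ) :
    ∃ C, ∀ p, ‖iteratedFDeriv ℝ k (fun q => f (proj q)) p‖ ≤ C := by
  have hperiodic (p n : Plane) (hn : proj n = 0) :
      ‖iteratedFDeriv ℝ k (fun q => f (proj q)) (p + n)‖
        = ‖iteratedFDeriv ℝ k (fun q => f (proj q)) p‖ := by
    rw [← iteratedFDeriv_comp_add_right]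
    simp only [proj_add, hn, add_zero]
  obtain ⟨N, hN⟩ := exists_descent
    (F := fun p => ‖iteratedFDeriv ℝ k (fun q => f (proj q)) p‖) hperiodic
  have hcont : Continuous N := by
    refine isOpenQuotientMap_proj.isQuotientMap.continuous_iff.2 ?_
    rw [show N ∘ proj = fun p => ‖iteratedFDeriv ℝ k (fun q => f (proj q)) p‖ from funext hN]
    exact (ContDiff.continuous_iteratedFDeriv ENat.LEInfty.out hf).norm
  obtain ⟨C, hC⟩ := (isCompact_range hcont).isBounded.exists_norm_le
  exact ⟨C, fun p => hN p ▸ (le_abs_self _).trans (hC _ ⟨_, rfl⟩)⟩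

namespace LorentzMetric

variable {g : LorentzMetric}

theorem dist_iteratedFDeriv_of_comp_eq_add {h : LorentzMetric} {φ : Torus → ℝ} (hφ : IsSmooth φ)
    {t : ℝ} {i j : Fin 2} (hcomp : ∀ x, h.comp x i j = g.comp x i j + t * φ x) (k : ℕ)
    (p : Plane) :
    dist (iteratedFDeriv ℝ k (fun q => g.comp (proj q) i j) p)
      (iteratedFDeriv ℝ k (fun q => h.comp (proj q) i j) p)
      = |t| * ‖iteratedFDeriv ℝ k (fun q => φ (proj q)) p‖ := by
  have hk : (k : WithTop ℕ∞) ≤ ∞ := ENat.LEInfty.out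
  have hgk : ContDiff ℝ k fun q => g.comp (proj q) i j := (g.smooth i j).of_le hk
  have hφk : ContDiff ℝ k fun q => φ (proj q) := ContDiff.of_le hφ hk
  have htφk : ContDiff ℝ k (t • fun q => φ (proj q)) := hφk.const_smul t
  have hsum : (fun q => h.comp (proj q) i j)
      = (fun q => g.comp (proj q) i j) + t • fun q => φ (proj q) := funext fun q => hcomp (proj q)
  rw [hsum, iteratedFDeriv_add_apply hgk.contDiffAt htφk.contDiffAt,
    iteratedFDeriv_const_smul_apply hφk.contDiffAt, dist_self_add_right, norm_smul,
    Real.norm_eq_abs]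

theorem tendsto_crTopology_of_comp_eq_add {ι : Type*} {l : Filter ι} {h : ι → LorentzMetric}
    {t : ι → ℝ} {φ : Fin 2 → Fin 2 → Torus → ℝ} (ht : Filter.Tendsto t l (𝓝 0))
    (hφ : ∀ i j, IsSmooth (φ i j))
    (hcomp : ∀ n x i j, (h n).comp x i j = g.comp x i j + t n * φ i j x) (r : ℕ∞) :
    Filter.Tendsto h l (@nhds _ (crTopology r) g) := by
  rw [nhds_induced, Filter.tendsto_comap_iff]
  refine tendsto_pi_nhds.2 fun k => tendsto_pi_nhds.2 fun i => tendsto_pi_nhds.2 fun j => ?_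
  rw [UniformFun.tendsto_iff_tendstoUniformly, Metric.tendstoUniformly_iff]
  intro ε hε
  obtain ⟨C, hC⟩ := (hφ i j).exists_norm_iteratedFDeriv_le k
  have hsmall : Filter.Tendsto (fun n => |t n| * C) l (𝓝 0) := by
    simpa only [abs_zero, zero_mul] using ht.abs.mul_const C
  filter_upwards [hsmall.eventually_lt_const hε] with n hn p
  refine lt_of_le_of_lt ?_ hn
  refine (dist_iteratedFDeriv_of_comp_eq_add (hφ i j) (hcomp n · i j) k p).trans_le ?_
  exact mul_le_mul_of_nonneg_left (hC p) (abs_nonneg _)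

theorem mem_closure_of_comp_eq_add {S : Set LorentzMetric} {φ : Fin 2 → Fin 2 → Torus → ℝ}
    (hφ : ∀ i j, IsSmooth (φ i j))
    (h : ∀ η : ℝ, 0 < η → ∃ t : ℝ, |t| < η ∧ ∃ h ∈ S, ∀ x i j,
      h.comp x i j = g.comp x i j + t * φ i j x) (r : ℕ∞) : g ∈ closure[crTopology r] S := by
  choose t ht h hS hcomp using fun n : ℕ => h (1 / (n + 1)) (by positivity)
  have ht₀ : Filter.Tendsto t Filter.atTop (𝓝 0) :=
    squeeze_zero_norm (fun n => (ht n).le) tendsto_one_div_add_atTop_nhds_zero_nat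
  let _ : TopologicalSpace LorentzMetric := crTopology r
  exact mem_closure_of_tendsto (tendsto_crTopology_of_comp_eq_add ht₀ hφ hcomp r)
    (Filter.Eventually.of_forall hS)

/-- The metric `a ⊗ b + b ⊗ a`. -/
def symProd (a b : Torus → Plane) (ha : ∀ i, IsSmooth fun x => a x i)
    (hb : ∀ i, IsSmooth fun x => b x i) (hw : ∀ x, wedge (a x) (b x) ≠ 0) : LorentzMetric where
  comp x := Matrix.of fun i j => a x i * b x j + a x j * b x i
  smooth i j := ((ha i).mul (hb j)).add ((ha j).mul (hb i))
  symm x := Matrix.IsSymm.ext fun i j => add_comm _ _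
  lorentzian x := by
    have hdet : (Matrix.of fun i j => a x i * b x j + a x j * b x i).det
        = -(wedge (a x) (b x)) ^ 2 := by
      simp only [Matrix.det_fin_two, Matrix.of_apply, wedge]
      ring
    rw [hdet]
    exact neg_lt_zero.2 (sq_pos_of_ne_zero (hw x))

end LorentzMetric

/-! ### Incomplete geodesics -/

/-- The function `u` on the plane has differential `a`. -/
structure IsPrimitive (a : Torus → Plane) (u : Plane → ℝ) : Prop where
  contDiff : ContDiff ℝ ∞ u
  pderiv_eq : ∀ i p, pderiv i u p = a (proj p) i

/-- The deck transformations of the plane change the primitive `u` of `a` by integers. -/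
structure IsIntegralPrimitive (a : Torus → Plane) (u : Plane → ℝ) : Prop
    extends IsPrimitive a u where
  exists_int : ∀ p n, proj n = 0 → ∃ z : ℤ, u (p + n) = u p + z

namespace IsPrimitive

variable {a : Torus → Plane} {u : Plane → ℝ}

theorem hasDerivAt_comp_curve (hu : IsPrimitive a u) {c : ℝ → Plane} {v : Plane} {t : ℝ}
    (hc : HasDerivAt c v t) : HasDerivAt (fun s => u (c s)) (a (proj (c t)) ⬝ᵥ v) t := by
  simpa only [hu.pderiv_eq, dotProduct] using
    LorentzTorus.hasDerivAt_comp_curve (hu.contDiff.differentiable (by simp) (c t)) hc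

theorem surjective (hu : IsPrimitive a u) {X : Torus → Plane} (hX : ∀ i, IsSmooth fun x => X x i)
    (haX : ∀ x, a x ⬝ᵥ X x = 1) : Function.Surjective u := by
  intro y
  obtain ⟨q, -, hq⟩ := exists_integralCurve hX 0
  have huq (t : ℝ) : HasDerivAt (fun s => u (q s) - s) 0 t := by
    simpa only [haX, sub_self] using (hu.hasDerivAt_comp_curve (hq t)).fun_sub (hasDerivAt_id' t)
  have hconst (t : ℝ) : u (q t) - t = u (q 0) - 0 :=
    is_const_of_deriv_eq_zero (fun s => (huq s).differentiableAt) (fun s => (huq s).deriv) t 0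
  exact ⟨q (y - u (q 0)), by linarith [hconst (y - u (q 0))]⟩

end IsPrimitive

/-- For the metric `a ⊗ B + B ⊗ a + φ(u) B ⊗ B` with `a = du`, the functions `U`, `A` and `m / t`
of the time `t` satisfy the equations of `u`, `a(c')` and `B(c')` along a geodesic `c` whose
velocity is orthogonal to the kernel of `a`. The numerator `m` isolates the singularity at
`t = 0`. -/
structure IsSingularSolution (φ φ' U A m : ℝ → ℝ) : Prop where
  contDiff_left : ContDiff ℝ 1 A
  contDiff_right : ContDiff ℝ 1 m
  ne_zero : ∀ t, m t ≠ 0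
  hasDerivAt_height : ∀ t, HasDerivAt U (A t) t
  hasDerivAt_right : ∀ t, 0 < t →
    HasDerivAt (fun s => m s / s) (φ' (U t) / 2 * (m t / t) ^ 2) t
  orthogonal : ∀ t, 0 < t → A t + φ (U t) * (m t / t) = 0

namespace LorentzMetric

/-- The metric is `a ⊗ B + B ⊗ a + F B ⊗ B` with `a` closed. -/
structure IsSheared (k : LorentzMetric) (a B : Torus → Plane) (F : Torus → ℝ) : Prop where
  closed : IsClosedForm a
  smooth : ∀ i, IsSmooth fun x => B x i
  smooth_coeff : IsSmooth F
  comp_eq : ∀ x i j, k.comp x i j = a x i * B x j + a x j * B x i + F x * (B x i * B x j)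

namespace IsSheared

variable {k : LorentzMetric} {a B : Torus → Plane} {F : Torus → ℝ}

theorem wedge_ne_zero (h : k.IsSheared a B F) (x : Torus) : wedge (a x) (B x) ≠ 0 := by
  have hfactor : wedge (a x + (F x / 2) • B x) (B x) ≠ 0 :=
    wedge_ne_zero_of_comp_eq (g := k) (x := x) (c := 1) fun i j => by
      simp only [h.comp_eq, Pi.add_apply, Pi.smul_apply, smul_eq_mul]
      ring
  convert hfactor using 1
  simp only [wedge, Pi.add_apply, Pi.smul_apply, smul_eq_mul]
  ring

theorem inner_self (h : k.IsSheared a B F) (x : Torus) (w : Plane) :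
    k.inner x w w = (2 * (a x ⬝ᵥ w) + F x * (B x ⬝ᵥ w)) * (B x ⬝ᵥ w) := by
  simp only [inner, h.comp_eq, dotProduct, Fin.sum_univ_two]
  ring

theorem partialDeriv_comp (h : k.IsSheared a B F) (l i j : Fin 2) (x : Torus) :
    partialDeriv l (fun y => k.comp y i j) x
      = partialDeriv l (fun y => a y i) x * B x j + a x i * partialDeriv l (fun y => B y j) x
        + (partialDeriv l (fun y => a y j) x * B x i + a x j * partialDeriv l (fun y => B y i) x)
        + (partialDeriv l F x * (B x i * B x j)
          + F x * (partialDeriv l (fun y => B y i) x * B x j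
            + B x i * partialDeriv l (fun y => B y j) x)) := by
  have ha := h.closed.smooth
  have hB := h.smooth
  simp only [h.comp_eq]
  rw [partialDeriv_add (((ha i).mul (hB j)).add ((ha j).mul (hB i)))
      (h.smooth_coeff.mul ((hB i).mul (hB j))),
    partialDeriv_add ((ha i).mul (hB j)) ((ha j).mul (hB i)), partialDeriv_mul (ha i) (hB j),
    partialDeriv_mul (ha j) (hB i), partialDeriv_mul h.smooth_coeff ((hB i).mul (hB j)),
    partialDeriv_mul (hB i) (hB j)]

/-- By `horth` the momentum of the curve is `β a`. -/
theorem hasDerivAt_accel (h : k.IsSheared a B F) {c v : ℝ → Plane} {β : ℝ → ℝ} {t F' : ℝ}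
    (hc : HasDerivAt c (v t) t) (hv : DifferentiableAt ℝ v t)
    (hF : ∀ l, partialDeriv l F (proj (c t)) = F' * a (proj (c t)) l)
    (hBv : ∀ᶠ s in 𝓝 t, B (proj (c s)) ⬝ᵥ v s = β s)
    (horth : ∀ᶠ s in 𝓝 t, a (proj (c s)) ⬝ᵥ v s + F (proj (c s)) * β s = 0)
    (hβ : HasDerivAt β (F' / 2 * β t ^ 2) t) :
    HasDerivAt v (k.accel (proj (c t)) (v t)) t := by
  refine hasDerivAt_accel_of_momentum hc hv fun l => ?_
  have hmomentum : (fun s => ∑ j, k.comp (proj (c s)) l j * v s j)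
      =ᶠ[𝓝 t] fun s => β s * a (proj (c s)) l := by
    filter_upwards [hBv, horth] with s hs hs'
    simp only [dotProduct, Fin.sum_univ_two] at hs hs'
    simp only [h.comp_eq, Fin.sum_univ_two]
    linear_combination (a (proj (c s)) l + F (proj (c s)) * B (proj (c s)) l) * hs
      + B (proj (c s)) l * hs'
  refine ((hβ.mul (h.closed.hasDerivAt_comp_proj_curve hc l)).congr_of_eventuallyEq
    hmomentum).congr_deriv ?_
  have hBt := hBv.self_of_nhds
  have hat := horth.self_of_nhds
  rw [← hBt] at hat ⊢
  simp only [dotProduct, Fin.sum_univ_two] at hat ⊢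
  simp only [h.partialDeriv_comp, hF]
  linear_combination -(partialDeriv l (fun y => B y 0) (proj (c t)) * v t 0
    + partialDeriv l (fun y => B y 1) (proj (c t)) * v t 1) * hat

theorem exists_curve (h : k.IsSheared a B F) {u : Plane → ℝ} (hu : IsPrimitive a u)
    {U A m : ℝ → ℝ} (hA : ContDiff ℝ 1 A) (hm : ContDiff ℝ 1 m)
    (hU : ∀ t, HasDerivAt U (A t) t) : ∃ c : ℝ → Plane, ∀ t ∈ Set.Ioo 0 1,
      HasDerivAt c (dualField a B (A t) (m t / t) (proj (c t))) t ∧ u (c t) = U t := by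
  have hX := isSmooth_dualField h.closed.smooth h.smooth h.wedge_ne_zero
  obtain ⟨p, hp⟩ := hu.surjective (hX 1 0)
    (fun x => left_dotProduct_dualField (h.wedge_ne_zero x) 1 0) (U (1 / 2))
  obtain ⟨c, hcp, hc⟩ := exists_integralCurve_singular (hX 1 0) (hX 0 1) hA hm p
  simp only [← dualField_eq_smul_add] at hc
  refine ⟨c, fun t ht => ⟨hc t ht, ?_⟩⟩
  have huU : ∀ s ∈ Set.Ioo (0 : ℝ) 1, HasDerivAt (fun s => u (c s) - U s) 0 s := fun s hs => by
    simpa only [left_dotProduct_dualField (h.wedge_ne_zero _), sub_self] using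
      (hu.hasDerivAt_comp_curve (hc s hs)).fun_sub (hU s)
  have hconst := isOpen_Ioo.is_const_of_deriv_eq_zero isPreconnected_Ioo
    (fun s hs => (huU s hs).differentiableAt.differentiableWithinAt)
    (fun s hs => (huU s hs).deriv) ht (show (1 / 2 : ℝ) ∈ Set.Ioo 0 1 by norm_num)
  rwa [hcp, hp, sub_self, sub_eq_zero] at hconst

theorem exists_singular_geodesic (h : k.IsSheared a B F) {u : Plane → ℝ} (hu : IsPrimitive a u)
    {φ φ' U A m : ℝ → ℝ} (hφ : ∀ y, HasDerivAt φ (φ' y) y) (hF : ∀ p, F (proj p) = φ (u p))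
    (hsol : IsSingularSolution φ φ' U A m) : ∃ c v : ℝ → Plane,
      (∀ t ∈ Set.Ioo 0 1, HasDerivAt c (v t) t ∧ HasDerivAt v (k.accel (proj (c t)) (v t)) t) ∧
      (∀ t, a (proj (c t)) ⬝ᵥ v t = A t) ∧ (∀ t, B (proj (c t)) ⬝ᵥ v t = m t / t) ∧
      ∀ t ∈ Set.Ioo 0 1, A t + F (proj (c t)) * (m t / t) = 0 := by
  obtain ⟨c, hc⟩ := h.exists_curve hu hsol.contDiff_left hsol.contDiff_right
    hsol.hasDerivAt_height
  let v : ℝ → Plane := fun t => dualField a B (A t) (m t / t) (proj (c t))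
  have hav (t : ℝ) : a (proj (c t)) ⬝ᵥ v t = A t :=
    left_dotProduct_dualField (h.wedge_ne_zero _) _ _
  have hBv (t : ℝ) : B (proj (c t)) ⬝ᵥ v t = m t / t :=
    right_dotProduct_dualField (h.wedge_ne_zero _) _ _
  have horth : ∀ t ∈ Set.Ioo (0 : ℝ) 1, A t + F (proj (c t)) * (m t / t) = 0 := fun t ht => by
    rw [hF, (hc t ht).2, hsol.orthogonal t ht.1]
  refine ⟨c, v, fun t ht => ⟨(hc t ht).1, ?_⟩, hav, hBv, horth⟩
  have hv : DifferentiableAt ℝ v t :=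
    differentiableAt_dualField_comp_proj h.closed.smooth h.smooth h.wedge_ne_zero
      (hsol.contDiff_left.differentiable one_ne_zero t)
      (hsol.hasDerivAt_right t ht.1).differentiableAt (hc t ht).1.differentiableAt
  refine h.hasDerivAt_accel (hc t ht).1 hv (F' := φ' (U t)) (fun l => ?_)
    (Filter.Eventually.of_forall hBv) ?_ (hsol.hasDerivAt_right t ht.1)
  · rw [partialDeriv_proj h.smooth_coeff]
    simp only [hF]
    rw [pderiv_comp (hφ _) (hu.contDiff.differentiable (by simp) _), hu.pderiv_eq, (hc t ht).2]
  · filter_upwards [isOpen_Ioo.mem_nhds ht] with s hs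
    rw [hav, horth s hs]

end IsSheared

theorem not_extendsToLine_of_singular {g : LorentzMetric} {c v : ℝ → Plane} {B : Torus → Plane}
    {m : ℝ → ℝ} (hB : ∀ i, IsSmooth fun x => B x i)
    (hc : ∀ t ∈ Set.Ioo 0 1, HasDerivAt c (v t) t) (hBv : ∀ t, B (proj (c t)) ⬝ᵥ v t = m t / t)
    (hm : ContinuousAt m 0) (hm₀ : m 0 ≠ 0) :
    ¬ g.ExtendsToLine (fun t => proj (c t)) (Set.Ioo 0 1) := by
  rintro ⟨γ, w, hγ, hγc⟩
  have hw : ContinuousAt w 0 := (hasDerivAt_pi.2 (hγ 0 trivial).2).continuousAt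
  have hγ₀ : ContinuousAt γ 0 := (hγ 0 trivial).1.continuousAt
  have hBw : ContinuousAt (fun t => B (γ t) ⬝ᵥ w t) 0 := by
    simp only [dotProduct]
    exact tendsto_finsetSum _ fun i _ =>
      ((hB i).continuous.continuousAt.comp hγ₀).mul ((continuous_apply i).continuousAt.comp hw)
  have hprod : (fun t => t * (B (γ t) ⬝ᵥ w t)) =ᶠ[𝓝[>] 0] m := by
    filter_upwards [Ioo_mem_nhdsGT one_pos] with t ht
    have hvel : w t = v t := (hγ t trivial).1.unique (hasVelocityAt_proj (hc t ht))
      (hγc.eventuallyEq_of_mem (isOpen_Ioo.mem_nhds ht))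
    rw [hγc ht, hvel, hBv, mul_div_cancel₀ _ ht.1.ne']
  have hlim := (continuousAt_id.mul hBw).tendsto.mono_left (nhdsWithin_le_nhds (s := Set.Ioi 0))
  refine hm₀ ((tendsto_nhds_unique (hlim.congr' hprod)
    (hm.tendsto.mono_left nhdsWithin_le_nhds)).symm.trans ?_)
  exact zero_mul _

theorem IsSheared.isIncompleteFor {k : LorentzMetric} {a B : Torus → Plane} {F : Torus → ℝ}
    (h : k.IsSheared a B F) {u : Plane → ℝ} (hu : IsPrimitive a u) {φ φ' U A m : ℝ → ℝ}
    (hφ : ∀ y, HasDerivAt φ (φ' y) y) (hF : ∀ p, F (proj p) = φ (u p))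
    (hsol : IsSingularSolution φ φ' U A m) {C : Torus → Plane → Prop}
    (hC : ∀ t, 0 < t → ∀ x w, k.inner x w w = A t * (m t / t) → w ≠ 0 → C x w) :
    k.IsIncompleteFor C := by
  obtain ⟨c, v, hgeod, hav, hBv, horth⟩ := h.exists_singular_geodesic hu hφ hF hsol
  refine ⟨Set.Ioo 0 1, fun t => proj (c t), v, isOpen_Ioo, Set.ordConnected_Ioo,
    Set.nonempty_Ioo.2 one_pos, isGeodesicOn_proj hgeod, fun t ht => hC t ht.1 _ _ ?_ ?_,
    not_extendsToLine_of_singular h.smooth (fun t ht => (hgeod t ht).1) hBv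
      hsol.contDiff_right.continuous.continuousAt (hsol.ne_zero 0)⟩
  · rw [h.inner_self, hav, hBv]
    linear_combination m t / t * horth t ht
  · intro hv
    have hβ := hBv t
    rw [hv, dotProduct_zero] at hβ
    exact div_ne_zero (hsol.ne_zero t) ht.1.ne' hβ.symm

end LorentzMetric

/-- The coefficient of the metrics `a ⊗ B + B ⊗ a + κ profile(u) B ⊗ B` used as perturbations. It
is `1`-periodic, hence descends to the torus when the periods of `u` are integers, and turns into
the rational function `x / (1 + x²)²` under the substitution `y = arctan x / π`. -/
def profile (y : ℝ) : ℝ := Real.sin (Real.pi * y) * Real.cos (Real.pi * y) ^ 3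

theorem hasDerivAt_profile (y : ℝ) :
    HasDerivAt profile (Real.pi * (Real.cos (Real.pi * y) ^ 4
      - 3 * Real.sin (Real.pi * y) ^ 2 * Real.cos (Real.pi * y) ^ 2)) y := by
  have hlin : HasDerivAt (fun y => Real.pi * y) Real.pi y := by
    simpa only [mul_one] using (hasDerivAt_id' y).const_mul Real.pi
  refine (hlin.sin.fun_mul (hlin.cos.fun_pow 3)).congr_deriv ?_
  push_cast
  ring

theorem contDiff_profile : ContDiff ℝ ∞ profile := by
  unfold profile
  fun_prop

theorem profile_add_intCast (y : ℝ) (z : ℤ) : profile (y + z) = profile y := by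
  have hdouble (x : ℝ) :
      Real.sin x * Real.cos x ^ 3 = Real.sin (2 * x) * (1 + Real.cos (2 * x)) / 4 := by
    rw [Real.sin_two_mul, Real.cos_two_mul]
    ring
  have hshift : 2 * (Real.pi * (y + z)) = 2 * (Real.pi * y) + z * (2 * Real.pi) := by ring
  simp only [profile]
  rw [hdouble, hdouble, hshift, Real.sin_add_int_mul_two_pi, Real.cos_add_int_mul_two_pi]

theorem profile_arctan_div_pi (x : ℝ) :
    profile (Real.arctan x / Real.pi) * (1 + x ^ 2) ^ 2 = x := by
  have hpos : 0 < 1 + x ^ 2 := by positivity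
  have hsq : √(1 + x ^ 2) ^ 2 = 1 + x ^ 2 := Real.sq_sqrt hpos.le
  have hne : √(1 + x ^ 2) ≠ 0 := (Real.sqrt_pos.2 hpos).ne'
  rw [profile, mul_div_cancel₀ _ Real.pi_ne_zero, Real.sin_arctan, Real.cos_arctan]
  nth_rewrite 3 [← hsq]
  field_simp

theorem deriv_profile_arctan_div_pi (x : ℝ) :
    deriv profile (Real.arctan x / Real.pi) * (1 + x ^ 2) ^ 2 = Real.pi * (1 - 3 * x ^ 2) := by
  have hcos : Real.cos (Real.arctan x) ^ 2 = 1 / (1 + x ^ 2) := Real.cos_sq_arctan x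
  have hsin : Real.sin (Real.arctan x) ^ 2 = x ^ 2 / (1 + x ^ 2) := by
    rw [Real.sin_sq, hcos]
    field_simp
    ring
  have hcos₄ : Real.cos (Real.arctan x) ^ 4 = (1 / (1 + x ^ 2)) ^ 2 := by
    rw [← hcos]
    ring
  rw [(hasDerivAt_profile _).deriv, mul_div_cancel₀ _ Real.pi_ne_zero, hcos₄, hsin, hcos]
  field_simp

theorem isSingularSolution_profile {κ m₀ : ℝ} (hm₀ : m₀ * κ * Real.pi = -2) (s : ℝ) :
    IsSingularSolution (fun y => κ * profile y) (fun y => κ * deriv profile y)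
      (fun t => Real.arctan (s * t ^ 2) / Real.pi)
      (fun t => 2 * s * t / (Real.pi * (1 + (s * t ^ 2) ^ 2)))
      (fun t => m₀ * (1 + (s * t ^ 2) ^ 2)) := by
  have hden (t : ℝ) : 1 + (s * t ^ 2) ^ 2 ≠ 0 := by positivity
  have hπ : Real.pi ≠ 0 := Real.pi_ne_zero
  have hsq (t : ℝ) : HasDerivAt (fun t : ℝ => s * t ^ 2) (s * (2 * t)) t := by
    simpa using (hasDerivAt_pow 2 t).const_mul s
  refine ⟨?_, by fun_prop, fun t => mul_ne_zero ?_ (hden t), fun t => ?_, fun t ht => ?_,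
    fun t ht => ?_⟩
  · exact ContDiff.div (by fun_prop) (by fun_prop) fun t => mul_ne_zero hπ (hden t)
  · rintro rfl
    norm_num at hm₀
  · refine ((hsq t).arctan.div_const Real.pi).congr_deriv ?_
    have := hden t
    field_simp
  · refine (((((hsq t).fun_pow 2).const_add 1).const_mul m₀).fun_div (hasDerivAt_id' t)
      ht.ne').congr_deriv ?_
    have hprofile := deriv_profile_arctan_div_pi (s * t ^ 2)
    push_cast
    rw [div_pow, mul_pow, ← sub_eq_zero]
    field_simp
    linear_combination -(κ * m₀ ^ 2) * hprofile - m₀ * (1 - 3 * (s * t ^ 2) ^ 2) * hm₀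
  · have hprofile := profile_arctan_div_pi (s * t ^ 2)
    have := hden t
    field_simp
    linear_combination m₀ * κ * Real.pi * hprofile + s * t ^ 2 * hm₀

namespace LorentzMetric

variable {k : LorentzMetric} {a B : Torus → Plane} {F : Torus → ℝ}

theorem IsSheared.isIncompleteFor_of_profile (h : k.IsSheared a B F) {u : Plane → ℝ}
    (hu : IsPrimitive a u) {κ : ℝ} (hκ : κ ≠ 0) (hF : ∀ p, F (proj p) = κ * profile (u p)) (s : ℝ)
    {C : Torus → Plane → Prop}
    (hC : ∀ x w, k.inner x w w = -4 * s / (κ * Real.pi ^ 2) → w ≠ 0 → C x w) :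
    k.IsIncompleteFor C := by
  have hπ : Real.pi ≠ 0 := Real.pi_ne_zero
  have hm₀ : -2 / (κ * Real.pi) * κ * Real.pi = -2 := by field_simp
  refine h.isIncompleteFor hu
    (fun y => (hasDerivAt_profile y).differentiableAt.hasDerivAt.const_mul κ) hF
    (isSingularSolution_profile hm₀ s) fun t ht x w hw => hC x w ?_
  have : 1 + (s * t ^ 2) ^ 2 ≠ 0 := by positivity
  rw [hw]
  field_simp
  ring

theorem IsSheared.isIncomplete_of_profile (h : k.IsSheared a B F) {u : Plane → ℝ}
    (hu : IsPrimitive a u) {κ : ℝ} (hκ : 0 < κ) (hF : ∀ p, F (proj p) = κ * profile (u p)) :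
    k.IsTimelikeIncomplete ∧ k.IsLightlikeIncomplete ∧ k.IsSpacelikeIncomplete := by
  have hpos : 0 < κ * Real.pi ^ 2 := by positivity
  refine ⟨h.isIncompleteFor_of_profile hu hκ.ne' hF 1 fun x w hw _ => ?_,
    h.isIncompleteFor_of_profile hu hκ.ne' hF 0 fun x w hw hw₀ => ⟨?_, hw₀⟩,
    h.isIncompleteFor_of_profile hu hκ.ne' hF (-1) fun x w hw _ => ?_⟩
  · rw [IsTimelike, hw]
    exact div_neg_of_neg_of_pos (by norm_num) hpos
  · rw [hw, mul_zero, zero_div]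
  · rw [IsSpacelike, hw]
    exact div_pos (by norm_num) hpos

theorem IsNullCoframe.mem_closure_of_isIntegralPrimitive {g : LorentzMetric} {Ω : Torus → ℝ}
    {b : Torus → Plane} (h : g.IsNullCoframe Ω a b) {u : Plane → ℝ}
    (hu : IsIntegralPrimitive a u) (r : ℕ∞) :
    g ∈ closure[crTopology r] {k : LorentzMetric |
      k.IsTimelikeIncomplete ∧ k.IsLightlikeIncomplete ∧ k.IsSpacelikeIncomplete} := by
  obtain ⟨f, hfu⟩ := exists_descent (F := fun p => profile (u p)) fun p n hn => by
    obtain ⟨z, hz⟩ := hu.exists_int p n hn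
    rw [hz, profile_add_intCast]
  have hf : IsSmooth f := by
    simpa only [IsSmooth, hfu, Function.comp_def] using contDiff_profile.comp hu.contDiff
  have hB : ∀ i, IsSmooth fun x => (Ω x • b x) i := fun i => h.smooth.mul (h.right.smooth i)
  refine mem_closure_of_comp_eq_add (φ := fun i j x => 2 * f x * ((Ω x * b x i) * (Ω x * b x j)))
    (fun i j => ((IsSmooth.const 2).mul hf).mul ((hB i).mul (hB j))) (fun η hη => ?_) r
  have hwedge (x : Torus) : wedge (a x + (η / 2 * f x) • (Ω x • b x)) (Ω x • b x) ≠ 0 := by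
    convert mul_ne_zero (h.pos x).ne' (h.wedge_ne_zero x) using 1
    simp only [wedge, Pi.add_apply, Pi.smul_apply, smul_eq_mul]
    ring
  let k := symProd _ _
    (fun i => (h.left.smooth i).add (((IsSmooth.const (η / 2)).mul hf).mul (hB i))) hB hwedge
  have hk (x : Torus) (i j : Fin 2) : k.comp x i j
      = a x i * (Ω x • b x) j + a x j * (Ω x • b x) i
        + η * f x * ((Ω x • b x) i * (Ω x • b x) j) := by
    simp only [k, symProd, Matrix.of_apply, Pi.smul_apply, smul_eq_mul]
    ring
  have hsheared : k.IsSheared a (fun x => Ω x • b x) (fun x => η * f x) :=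
    ⟨h.left, hB, (IsSmooth.const η).mul hf, hk⟩
  refine ⟨η / 2, by rw [abs_of_pos (half_pos hη)]; exact half_lt_self hη, k,
    hsheared.isIncomplete_of_profile hu.toIsPrimitive hη fun p => by rw [hfu], fun x i j => ?_⟩
  rw [hk, h.comp_eq]
  simp only [Pi.smul_apply, smul_eq_mul]
  ring

end LorentzMetric

/-! ### Commensurable periods -/

theorem proj_single_one (i : Fin 2) : proj (Pi.single i 1) = 0 := by
  refine proj_eq_zero_iff.2 fun j => ?_
  obtain rfl | hj := eq_or_ne j i
  · exact ⟨1, by rw [Pi.single_eq_same, Int.cast_one]⟩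
  · exact ⟨0, by rw [Pi.single_eq_of_ne hj, Int.cast_zero]⟩

theorem IsClosedForm.exists_isPrimitive {a : Torus → Plane} (ha : IsClosedForm a) :
    ∃ (u : Plane → ℝ) (l : Plane), IsPrimitive a u ∧
      ∀ p n, proj n = 0 → u (p + n) = u p + l ⬝ᵥ n := by
  obtain ⟨u, hu, hua⟩ := exists_primitive ha.contDiff ha.pderiv_comm
  have hdiff : Differentiable ℝ u := hu.differentiable (by simp)
  have hperiod (i : Fin 2) : ∃ c, ∀ p, u (p + Pi.single i 1) = u p + c :=
    exists_eq_add_const (F := fun p => u (p + Pi.single i 1)) (by fun_prop) hdiff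
      fun j p => by rw [pderiv_comp_add_right, hua, hua, proj_add_eq_self (proj_single_one i)]
  choose l hl using hperiod
  have hperiodic (i : Fin 2) : Function.Periodic (fun p => u p - l ⬝ᵥ p) (Pi.single i 1) :=
    fun p => by
      simp only [hl, dotProduct_add, dotProduct_single_one]
      ring
  refine ⟨u, l, ⟨hu, hua⟩, fun p n hn => ?_⟩
  choose z hz using proj_eq_zero_iff.1 hn
  have hn : n = z 0 • Pi.single 0 1 + z 1 • Pi.single 1 1 := by
    ext i
    fin_cases i <;> simp [hz]
  have hinv : u (p + n) - l ⬝ᵥ (p + n) = u p - l ⬝ᵥ p :=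
    hn ▸ ((hperiodic 0).zsmul (z 0)).add_period ((hperiodic 1).zsmul (z 1)) p
  rw [dotProduct_add] at hinv
  linarith

namespace IsPrimitive

variable {a : Torus → Plane} {u : Plane → ℝ}

theorem add_const (hu : IsPrimitive a u) (e : Plane) :
    IsPrimitive (fun x => a x + e) fun p => u p + e ⬝ᵥ p where
  contDiff := hu.contDiff.add (by unfold dotProduct; fun_prop)
  pderiv_eq i p := by
    have hlin : HasFDerivAt (fun p : Plane => e ⬝ᵥ p)
        (∑ j, e j • ContinuousLinearMap.proj (R := ℝ) (φ := fun _ : Fin 2 => ℝ) j) p :=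
      HasFDerivAt.fun_sum fun j _ => (hasFDerivAt_apply j p).const_mul (e j)
    have hpderiv : pderiv i (fun p : Plane => e ⬝ᵥ p) p = e i := by
      rw [pderiv, hlin.fderiv]
      fin_cases i <;> simp
    rw [pderiv_add (hu.contDiff.differentiable (by simp) p) hlin.differentiableAt, hpderiv,
      hu.pderiv_eq, Pi.add_apply]

theorem const_smul (hu : IsPrimitive a u) (ρ : ℝ) :
    IsPrimitive (fun x => ρ • a x) fun p => ρ * u p where
  contDiff := contDiff_const.mul hu.contDiff
  pderiv_eq i p := by
    rw [pderiv_const_mul (hu.contDiff.differentiable (by simp) p), hu.pderiv_eq, Pi.smul_apply,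
      smul_eq_mul]

theorem isIntegralPrimitive (hu : IsPrimitive a u) {m : Fin 2 → ℤ}
    (hm : ∀ p n, proj n = 0 → u (p + n) = u p + (fun i => (m i : ℝ)) ⬝ᵥ n) :
    IsIntegralPrimitive a u where
  toIsPrimitive := hu
  exists_int p n hn := by
    choose z hz using proj_eq_zero_iff.1 hn
    refine ⟨m ⬝ᵥ z, ?_⟩
    rw [hm p n hn]
    simp only [dotProduct, hz, Int.cast_sum, Int.cast_mul]

end IsPrimitive

theorem exists_abs_lt_and_mul_eq_intCast (x y : ℝ) {η : ℝ} (hη : 0 < η) :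
    ∃ t : ℝ, |t| < η ∧ ∃ ρ : ℝ, ρ ≠ 0 ∧ ∃ m n : ℤ, ρ * (x + t) = m ∧ ρ * y = n := by
  obtain rfl | hy := eq_or_ne y 0
  · obtain rfl | hx := eq_or_ne x 0
    · exact ⟨0, by simpa using hη, 1, one_ne_zero, 0, 0, by simp, by simp⟩
    · exact ⟨0, by simpa using hη, x⁻¹, inv_ne_zero hx, 1, 0, by simp [hx], by simp⟩
  · have hy' : 0 < |y| := abs_pos.2 hy
    obtain ⟨q, hq, hq'⟩ := exists_rat_btwn
      (show x / y < x / y + η / |y| from lt_add_of_pos_right _ (div_pos hη hy'))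
    have hden : (q.den : ℝ) ≠ 0 := Nat.cast_ne_zero.2 q.den_ne_zero
    have hnum : (q : ℝ) * q.den = q.num := mod_cast Rat.mul_den_eq_num q
    refine ⟨(q - x / y) * y, ?_, q.den / y, div_ne_zero hden hy, q.num, q.den, ?_, ?_⟩
    · rw [abs_mul, abs_of_pos (sub_pos.2 hq), ← lt_div_iff₀ hy']
      linarith
    · rw [← hnum]
      field_simp
      ring
    · rw [div_mul_cancel₀ _ hy, Int.cast_natCast]

theorem IsClosedForm.exists_smul_add_isIntegralPrimitive {a : Torus → Plane}
    (ha : IsClosedForm a) {η : ℝ} (hη : 0 < η) : ∃ t : ℝ, |t| < η ∧ ∃ ρ : ℝ, ρ ≠ 0 ∧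
      ∃ u, IsIntegralPrimitive (fun x => ρ • (a x + t • Pi.single 0 1)) u := by
  obtain ⟨u, l, hu, hl⟩ := ha.exists_isPrimitive
  obtain ⟨t, ht, ρ, hρ, m, n, hm, hn⟩ := exists_abs_lt_and_mul_eq_intCast (l 0) (l 1) hη
  refine ⟨t, ht, ρ, hρ, _, ((hu.add_const _).const_smul ρ).isIntegralPrimitive (m := ![m, n])
    fun p v hv => ?_⟩
  simp only [hl p v hv, dotProduct, Fin.sum_univ_two, Matrix.cons_val_zero, Matrix.cons_val_one,
    Matrix.cons_val_fin_one, ← hm, ← hn, Pi.add_apply, Pi.smul_apply, Pi.single_eq_same,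
    Pi.single_eq_of_ne (one_ne_zero : (1 : Fin 2) ≠ 0), smul_eq_mul]
  ring

theorem exists_pos_forall_wedge_add_smul_ne_zero {a b : Torus → Plane}
    (ha : ∀ i, IsSmooth fun x => a x i) (hb : ∀ i, IsSmooth fun x => b x i)
    (hw : ∀ x, wedge (a x) (b x) ≠ 0) (e : Plane) :
    ∃ δ : ℝ, 0 < δ ∧ ∀ t : ℝ, |t| < δ → ∀ x, wedge (a x + t • e) (b x) ≠ 0 := by
  obtain ⟨M, hM, hbound⟩ := ((isSmooth_wedge (fun i => IsSmooth.const (e i)) hb).div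
    (isSmooth_wedge ha hb) hw).exists_abs_le
  refine ⟨1 / (M + 1), by positivity, fun t ht x hx => ?_⟩
  have hadd : wedge (a x + t • e) (b x) = wedge (a x) (b x) + t * wedge e (b x) := by
    simp only [wedge, Pi.add_apply, Pi.smul_apply, smul_eq_mul]
    ring
  have hratio : t * (wedge e (b x) / wedge (a x) (b x)) = -1 := by
    rw [← mul_div_assoc, div_eq_iff (hw x)]
    linarith
  have hone : |t| * |wedge e (b x) / wedge (a x) (b x)| = 1 := by
    rw [← abs_mul, hratio, abs_neg, abs_one]
  rw [lt_div_iff₀ (by positivity)] at ht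
  nlinarith [mul_le_mul_of_nonneg_left (hbound x) (abs_nonneg t), abs_nonneg t]

namespace LorentzMetric

variable {g : LorentzMetric} {Ω : Torus → ℝ} {a b : Torus → Plane}

theorem IsNullCoframe.mem_closure_exists_isIntegralPrimitive (h : g.IsNullCoframe Ω a b)
    (r : ℕ∞) : g ∈ closure[crTopology r] {k : LorentzMetric |
      ∃ Ω a b u, k.IsNullCoframe Ω a b ∧ IsIntegralPrimitive a u} := by
  let e : Plane := Pi.single 0 1
  have hB : ∀ i, IsSmooth fun x => (Ω x • b x) i := fun i => h.smooth.mul (h.right.smooth i)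
  have hwedge (x : Torus) : wedge (a x) (Ω x • b x) ≠ 0 := by
    convert mul_ne_zero (h.pos x).ne' (h.wedge_ne_zero x) using 1
    simp only [wedge, Pi.smul_apply, smul_eq_mul]
    ring
  obtain ⟨δ, hδ, hne⟩ := exists_pos_forall_wedge_add_smul_ne_zero h.left.smooth hB hwedge e
  refine mem_closure_of_comp_eq_add
    (φ := fun i j x => e i * (Ω x • b x) j + e j * (Ω x • b x) i)
    (fun i j => ((IsSmooth.const _).mul (hB j)).add ((IsSmooth.const _).mul (hB i)))
    (fun η hη => ?_) r
  obtain ⟨t, ht, ρ, hρ, u, hu⟩ := h.left.exists_smul_add_isIntegralPrimitive (lt_min hη hδ)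
  have ha : IsClosedForm fun x => a x + t • e := h.left.add (IsClosedForm.const _)
  let k := symProd _ _ ha.smooth hB (hne t (ht.trans_le (min_le_right _ _)))
  have hk : k.IsNullCoframe Ω (fun x => ρ • (a x + t • e)) fun x => ρ⁻¹ • b x :=
    ⟨h.smooth, h.pos, ha.const_smul ρ, h.right.const_smul ρ⁻¹, fun x i j => by
      simp only [k, symProd, Matrix.of_apply, Pi.smul_apply, smul_eq_mul]
      field_simp⟩
  refine ⟨t, ht.trans_le (min_le_left _ _), k, ⟨Ω, _, _, u, hk, hu⟩, fun x i j => ?_⟩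
  rw [h.comp_eq]
  simp only [k, symProd, Matrix.of_apply, Pi.add_apply, Pi.smul_apply, smul_eq_mul]
  ring

theorem IsNullCoframe.mem_closure_isIncomplete (h : g.IsNullCoframe Ω a b) (r : ℕ∞) :
    g ∈ closure[crTopology r] {k : LorentzMetric |
      k.IsTimelikeIncomplete ∧ k.IsLightlikeIncomplete ∧ k.IsSpacelikeIncomplete} := by
  let _ : TopologicalSpace LorentzMetric := crTopology r
  refine closure_minimal ?_ isClosed_closure (h.mem_closure_exists_isIntegralPrimitive r)
  rintro k ⟨Ω', a', b', u, hk, hu⟩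
  exact hk.mem_closure_of_isIntegralPrimitive hu r

theorem IsConformallyFlat.exists_isNullCoframe (h : g.IsConformallyFlat) :
    ∃ Ω a b, g.IsNullCoframe Ω a b := by
  obtain ⟨g₀, hflat, hconf⟩ := h
  obtain ⟨a, b, hab⟩ := hflat.exists_isNullCoframe
  obtain ⟨Ω, hΩ⟩ := hconf.isNullCoframe hab
  exact ⟨Ω, a, b, hΩ⟩

theorem isConformallyFlat_iff_exists_timelike : g.IsConformallyFlat ↔
    ∃ K : Torus → Plane, g.IsConformalField K ∧ ∀ x, g.IsTimelike x (K x) := by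
  refine ⟨fun hg => ?_, fun ⟨K, hK, htime⟩ => ?_⟩
  · obtain ⟨Ω, a, b, h⟩ := hg.exists_isNullCoframe
    refine ⟨_, h.isConformalField_dualField 1 (-1), fun x => ?_⟩
    rw [IsTimelike, h.inner_dualField]
    linarith [h.pos x]
  · obtain ⟨Ω, a, b, h⟩ := hK.exists_isNullCoframe (ε := -1) (by norm_num) fun x => by
      rw [neg_one_mul]
      exact neg_pos.2 (htime x)
    exact h.isConformallyFlat

theorem isConformallyFlat_iff_exists_spacelike : g.IsConformallyFlat ↔
    ∃ K : Torus → Plane, g.IsConformalField K ∧ ∀ x, g.IsSpacelike x (K x) := by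
  refine ⟨fun hg => ?_, fun ⟨K, hK, hspace⟩ => ?_⟩
  · obtain ⟨Ω, a, b, h⟩ := hg.exists_isNullCoframe
    refine ⟨_, h.isConformalField_dualField 1 1, fun x => ?_⟩
    rw [IsSpacelike, h.inner_dualField]
    linarith [h.pos x]
  · obtain ⟨Ω, a, b, h⟩ := hK.exists_isNullCoframe (ε := 1) (by norm_num) fun x => by
      rw [one_mul]
      exact hspace x
    exact h.isConformallyFlat

end LorentzMetric

end LorentzTorus

end

theorem mainTheorem7_general (g : LorentzTorus.LorentzMetric) :
    ((g.IsConformallyFlat ↔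
        ∃ K : LorentzTorus.Torus → LorentzTorus.Plane,
          g.IsConformalField K ∧ ∀ x, g.IsTimelike x (K x)) ∧
      (g.IsConformallyFlat ↔
        ∃ K : LorentzTorus.Torus → LorentzTorus.Plane,
          g.IsConformalField K ∧ ∀ x, g.IsSpacelike x (K x)) ∧
      (g.IsConformallyFlat → g.IsComplete)) ∧
    (∀ r : ℕ∞, g.IsConformallyFlat →
      g ∈ closure[LorentzTorus.LorentzMetric.crTopology r]
        {h | h.IsTimelikeIncomplete ∧ h.IsLightlikeIncomplete ∧ h.IsSpacelikeIncomplete}) := by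
  refine ⟨⟨LorentzTorus.LorentzMetric.isConformallyFlat_iff_exists_timelike,
    LorentzTorus.LorentzMetric.isConformallyFlat_iff_exists_spacelike, fun hg => ?_⟩,
    fun r hg => ?_⟩
  · obtain ⟨Ω, a, b, h⟩ := hg.exists_isNullCoframe
    exact h.isComplete
  · obtain ⟨Ω, a, b, h⟩ := hg.exists_isNullCoframe
    exact h.mem_closure_isIncomplete r

theorem mainTheorem7 (g : LorentzTorus.LorentzMetric) :
    ((g.IsConformallyFlat ↔
        ∃ K : LorentzTorus.Torus → LorentzTorus.Plane,
          g.IsConformalField K ∧ ∀ x, g.IsTimelike x (K x)) ∧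
      (g.IsConformallyFlat ↔
        ∃ K : LorentzTorus.Torus → LorentzTorus.Plane,
          g.IsConformalField K ∧ ∀ x, g.IsSpacelike x (K x)) ∧
      (g.IsConformallyFlat → g.IsComplete)) ∧
    (∀ r : ℕ∞,
      (g.IsConformallyFlat →
        g ∈ closure[LorentzTorus.LorentzMetric.crTopology r]
          {h | h.IsLightlikeIncomplete}) ∧
      (g.IsFlat →
        g ∈ closure[LorentzTorus.LorentzMetric.crTopology r]
          {h | h.IsTimelikeIncomplete ∧ h.IsLightlikeIncomplete ∧ h.IsSpacelikeIncomplete})) := by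
  obtain ⟨hequiv, hclosure⟩ := mainTheorem7_general g
  refine ⟨hequiv, fun r => ⟨fun hg => ?_, fun hg => hclosure r hg.isConformallyFlat⟩⟩
  let _ : TopologicalSpace LorentzTorus.LorentzMetric := LorentzTorus.LorentzMetric.crTopology r
  exact closure_mono (fun _ hk => hk.2.1) (hclosure r hg)
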